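/- Let $f:\mathbb R^n\to\mathbb R$ ($n\ge 1$) be three times continuously differentiable, with $f(x)\ge f_{\rm low}$, $\|\nabla^3 f(x)-\nabla^3 f(y)\|\le L\|x-y\|$ (with $L\ge 3$) and $\|\nabla^3 f(x)\|\le\kappa$ for all $x,y\in\mathbb R^n$, where $\|T\|=\max_{\|s_i\|=1}|T[s_1,s_2,s_3]|$. Fix $x_0\in\mathbb R^n$, $\sigma_0>0$, $\theta_1,\theta_2>1$ and an integer $m\ge1$, and put $\|s_j\|=1$ for $j<0$. For $k=0,1,2,\dots$ the algorithm computes a symmetric tensor $T_k$ (see below), puts $$\overline T_k(s)=f(x_k)+\nabla f(x_k)[s]+\tfrac12\nabla^2f(x_k)[s]^2+\tfrac1{3!}T_k[s]^3,\qquad m_k(s)=\overline T_k(s)+\tfrac{\sigma_k}{4!}\|s\|^4,$$ chooses any step $s_k$ with $$m_k(s_k)\le m_k(0),\quad \|\nabla\overline T_k(s_k)\|\le\tfrac{\theta_1\sigma_k\|s_k\|^3}{3!},\quad \max[0,-\lambda_{\min}(\nabla^2\overline T_k(s_k))]\le\tfrac{\theta_2\sigma_k\|s_k\|^2}{2!},$$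 and sets $x_{k+1}=x_k+s_k$, $\sigma_{k+1}=\sigma_k+\sigma_k\|s_k\|^4$. If $k \bmod m\ne0$, then $T_k$ is the PSB update: the minimizer of $\|T-T_{k-1}\|_F$ over all symmetric third-order tensors $T$ with $T[s_{k-1}]=\nabla^2f(x_k)-\nabla^2f(x_{k-1})$. If $k\bmod m=0$, then (a) in the variant with exact restarts, $T_k=\nabla^3f(x_k)$; (b) in the variant with finite-difference restarts, $T_k=P_{\rm sym}\Big(\sum_{i=1}^n\frac{\nabla^2f(x_k+h_ke_i)-\nabla^2f(x_k)}{h_k}\otimes e_i\Big)$ with $h_k=\min\big(\sum_{i=1}^m\|s_{k-i}\|,1\big)/\sqrt n$, where $P_{\rm sym}$ is the projection onto symmetric tensors. Each iteration evaluates $\nabla f(x_k)$ and $\nabla^2 f(x_k)$ once; a restart evaluates in addition, in (a), $\nabla^3f(x_k)$ and, in (b), the $n$ Hessians $\nabla^2f(x_k+h_ke_i)$. Then for each variant there is a constant $C>0$, which depends only on $m,\sigma_0,\theta_1,\theta_2,L,\kappa$ and on upper bounds for $f(x_0)-f_{\rm low}$, $\|\nabla f(x_0)\|$ and $\max[0,-\lambda_{\min}(\nabla^2f(x_0))]$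 (in particular, not on $n$), such that for every run and all $\epsilon_1,\epsilon_2>0$ with $\min(\epsilon_1,\epsilon_2)\le1$ some iterate $x_K$ satisfies $$\|\nabla f(x_K)\|\le\epsilon_1\quad\text{and}\quad\lambda_{\min}(\nabla^2f(x_K))\ge-\epsilon_2,$$ and the total number of evaluations made in iterations $0,\dots,K$ is (a) at most $C\max[\epsilon_1^{-4/3},\epsilon_2^{-2}]$ evaluations of the gradient, the Hessian and the third-order tensor for exact restarts; (b) at most $C\,n\max[\epsilon_1^{-4/3},\epsilon_2^{-2}]$ evaluations of the gradient and the Hessian for finite-difference restarts. -/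

import Mathlib

namespace PSBThree

/-- `ℝⁿ` with its Euclidean norm. -/
abbrev Vec (n : ℕ) := EuclideanSpace ℝ (Fin n)

/-- Multilinear maps `(ℝⁿ)^p → ℝ`. Their Mathlib norm is the operator norm
`max {|T[s₁, …, s_p]| : ‖s_i‖ = 1}`. -/
abbrev Tensor (p n : ℕ) := ContinuousMultilinearMap ℝ (fun _ : Fin p => Vec n) ℝ

/-- The `i`-th vector of the canonical basis of `ℝⁿ`. -/
noncomputable def basisVec {n : ℕ} (i : Fin n) : Vec n := EuclideanSpace.single i (1 : ℝ)

/-- `T` is symmetric: `T[s_{π(1)}, …, s_{π(p)}] = T[s₁, …, s_p]` for every permutation `π`. -/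
def IsSymmTensor {p n : ℕ} (T : Tensor p n) : Prop :=
  ∀ (π : Equiv.Perm (Fin p)) (v : Fin p → Vec n), T (fun i => v (π i)) = T v

/-- The projection `P_sym(T) = (1/p!) ∑_π π(T)`, where `π(T)[s₁, …] = T[s_{π(1)}, …]`. -/
noncomputable def symProj {p n : ℕ} (T : Tensor p n) : Tensor p n :=
  ((Nat.factorial p : ℝ)⁻¹) •
    ∑ π : Equiv.Perm (Fin p), ContinuousMultilinearMap.domDomCongr π T

/-- The Frobenius norm, the Euclidean norm of the array of the entries
`T[e_{i₁}, …, e_{i_p}]`. -/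
noncomputable def frobNorm {p n : ℕ} (T : Tensor p n) : ℝ :=
  Real.sqrt (∑ i : Fin p → Fin n, (T fun j => basisVec (i j)) ^ 2)

/-- The tensor `S ⊗ u`, that is `(S ⊗ u)[s₁, …, s_p, s_{p+1}] = S[s₁, …, s_p] · uᵀ s_{p+1}`. -/
noncomputable def outer {p n : ℕ} (S : Tensor p n) (u : Vec n) : Tensor (p + 1) n :=
  (S.smulRight (innerSL ℝ u)).uncurryRight

theorem symProj_apply {p n : ℕ} (T : Tensor p n) (v : Fin p → Vec n) :
    symProj T v =
      (Nat.factorial p : ℝ)⁻¹ * ∑ π : Equiv.Perm (Fin p), T (fun i => v (π i)) := by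
  simp [symProj]

theorem outer_apply {p n : ℕ} (S : Tensor p n) (u : Vec n) (v : Fin (p + 1) → Vec n) :
    outer S u v = S (fun i => v i.castSucc) * inner ℝ u (v (Fin.last p)) := by
  simp [outer, Fin.init_def]

/-- The matrix of second partial derivatives of `f` at `x`. -/
noncomputable def hessMatrix {n : ℕ} (f : Vec n → ℝ) (x : Vec n) : Matrix (Fin n) (Fin n) ℝ :=
  Matrix.of fun i j => iteratedFDeriv ℝ 2 f x ![basisVec i, basisVec j]

/-- The leftmost eigenvalue of a real symmetric matrix (of size at least one). -/
noncomputable def lambdaMin {n : ℕ} (M : Matrix (Fin n) (Fin n) ℝ) : ℝ :=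
  sInf (spectrum ℝ M)

/-- The approximate third-order Taylor expansion at `x`, as a function of the step `s`:
the third derivative is replaced by the tensor `T`. -/
noncomputable def approxTaylor {n : ℕ} (f : Vec n → ℝ) (x : Vec n) (T : Tensor 3 n)
    (s : Vec n) : ℝ :=
  f x + ∑ i ∈ Finset.Icc 1 2, 1 / (Nat.factorial i : ℝ) * iteratedFDeriv ℝ i f x (fun _ => s)
    + 1 / (Nat.factorial 3 : ℝ) * T (fun _ => s)

/-- The regularized model `m(s)` of `f (x + s)`. -/
noncomputable def model {n : ℕ} (f : Vec n → ℝ) (x : Vec n) (T : Tensor 3 n) (σ : ℝ)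
    (s : Vec n) : ℝ :=
  approxTaylor f x T s + σ / (Nat.factorial 4 : ℝ) * ‖s‖ ^ 4

/-- The tests that an acceptable trial step `s` passes: decrease of the model, and
approximate first- and second-order stationarity of the approximate Taylor expansion
(its gradient and its Hessian are taken with respect to the step). -/
structure IsTrialStep {n : ℕ} (f : Vec n → ℝ) (θ₁ θ₂ : ℝ) (x : Vec n) (T : Tensor 3 n)
    (σ : ℝ) (s : Vec n) : Prop where
  decrease : model f x T σ s - model f x T σ 0 ≤ 0
  first_order :
    ‖gradient (approxTaylor f x T) s‖ ≤ θ₁ * σ * ‖s‖ ^ 3 / (Nat.factorial 3 : ℝ)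
  second_order :
    max 0 (-lambdaMin (hessMatrix (approxTaylor f x T) s))
      ≤ θ₂ * σ * ‖s‖ ^ 2 / (Nat.factorial 2 : ℝ)

/-- The sequences produced by the algorithm: iterates, steps, regularization parameters and
approximations of the third derivative. -/
structure Iterates (n : ℕ) where
  x : ℕ → Vec n
  s : ℕ → Vec n
  σ : ℕ → ℝ
  T : ℕ → Tensor 3 n

/-- The part of the algorithm that does not depend on how the tensors `T k` are computed.
Every step is accepted, and any step that passes the tests may be taken. -/
structure IsRun {n : ℕ} (f : Vec n → ℝ) (θ₁ θ₂ σ₀ : ℝ) (x₀ : Vec n) (R : Iterates n) :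
    Prop where
  x_zero : R.x 0 = x₀
  σ_zero : R.σ 0 = σ₀
  step : ∀ k, IsTrialStep f θ₁ θ₂ (R.x k) (R.T k) (R.σ k) (R.s k)
  x_succ : ∀ k, R.x (k + 1) = R.x k + R.s k
  σ_succ : ∀ k, R.σ (k + 1) = R.σ k + R.σ k * ‖R.s k‖ ^ 4

/-- The symmetric tensors that satisfy the secant equation `T[s] = Y`. -/
def secantSet {n : ℕ} (s : Vec n) (Y : Tensor 2 n) : Set (Tensor 3 n) :=
  {T | IsSymmTensor T ∧ T.curryLeft s = Y}

/-- The high-order PSB update: `T` is the symmetric tensor closest to `Tprev` in the Frobenius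
norm among those that satisfy the secant equation `T[s] = Y`. -/
def IsPSBUpdate {n : ℕ} (Tprev : Tensor 3 n) (s : Vec n) (Y : Tensor 2 n) (T : Tensor 3 n) :
    Prop :=
  T ∈ secantSet s Y ∧ ∀ T' ∈ secantSet s Y, frobNorm (T - Tprev) ≤ frobNorm (T' - Tprev)

/-- The secant update that is made at every iteration `k` with `k mod m ≠ 0`. -/
def PSBBetweenRestarts {n : ℕ} (f : Vec n → ℝ) (m : ℕ) (R : Iterates n) : Prop :=
  ∀ k, k % m ≠ 0 →
    IsPSBUpdate (R.T (k - 1)) (R.s (k - 1))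
      (iteratedFDeriv ℝ 2 f (R.x k) - iteratedFDeriv ℝ 2 f (R.x (k - 1))) (R.T k)

/-- The finite-difference stepsize `h_k = min (∑_{i=1}^m ‖s_{k-i}‖, 1) / √n`, with the
convention `‖s_j‖ = 1` for `j < 0`. -/
noncomputable def fdStep {n : ℕ} (m : ℕ) (R : Iterates n) (k : ℕ) : ℝ :=
  min (∑ i ∈ Finset.Icc 1 m, if i ≤ k then ‖R.s (k - i)‖ else 1) 1 / Real.sqrt n

/-- The finite-difference tensor
`A = ∑ i, ((∇² f (x + h e_i) - ∇² f (x)) / h) ⊗ e_i`. -/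
noncomputable def fdTensor {n : ℕ} (f : Vec n → ℝ) (x : Vec n) (h : ℝ) : Tensor 3 n :=
  ∑ i : Fin n,
    outer (h⁻¹ • (iteratedFDeriv ℝ 2 f (x + h • basisVec i) - iteratedFDeriv ℝ 2 f x))
      (basisVec i)

/-- A run of the PSB variant with exact restarts: `T_k = ∇³ f (x_k)` if `k mod m = 0`. -/
structure IsLazyRestartRun {n : ℕ} (f : Vec n → ℝ) (m : ℕ) (θ₁ θ₂ σ₀ : ℝ) (x₀ : Vec n)
    (R : Iterates n) : Prop where
  run : IsRun f θ₁ θ₂ σ₀ x₀ R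
  restart : ∀ k, k % m = 0 → R.T k = iteratedFDeriv ℝ 3 f (R.x k)
  psb : PSBBetweenRestarts f m R

/-- A run of the PSB variant with finite-difference restarts: `T_k = P_sym(A_k)` if
`k mod m = 0`. (If `h_k = 0`, then a previous step was zero, and the iterate it was taken from
satisfies `∇ f = 0` and `∇² f ⪰ 0`; what the run does afterwards is irrelevant.) -/
structure IsFDRestartRun {n : ℕ} (f : Vec n → ℝ) (m : ℕ) (θ₁ θ₂ σ₀ : ℝ) (x₀ : Vec n)
    (R : Iterates n) : Prop where
  run : IsRun f θ₁ θ₂ σ₀ x₀ R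
  restart : ∀ k, k % m = 0 → R.T k = symProj (fdTensor f (R.x k) (fdStep m R k))
  psb : PSBBetweenRestarts f m R

/-- A call of the oracle: the evaluation of `∇^order f` at a point. -/
structure Query (n : ℕ) where
  order : ℕ
  point : Vec n

/-- The oracle calls of iteration `k` with exact restarts: the gradient and the Hessian at
`x_k`, and at a restart also the third derivative. (The secant update reuses the Hessian at
`x_{k-1}`; the value `f (x_k)` cancels in every test on the step.) -/
noncomputable def lazyQueries {n : ℕ} (m : ℕ) (R : Iterates n) (k : ℕ) : List (Query n) :=
  [⟨1, R.x k⟩, ⟨2, R.x k⟩] ++ if k % m = 0 then [⟨3, R.x k⟩] else []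

/-- The oracle calls of iteration `k` with finite-difference restarts: the gradient and the
Hessian at `x_k`, and at a restart also the Hessians at the points `x_k + h_k e_i`. -/
noncomputable def fdQueries {n : ℕ} (m : ℕ) (R : Iterates n) (k : ℕ) : List (Query n) :=
  [⟨1, R.x k⟩, ⟨2, R.x k⟩] ++
    if k % m = 0 then List.ofFn fun i : Fin n => ⟨2, R.x k + fdStep m R k • basisVec i⟩ else []

/-- The total number of oracle calls in iterations `0, …, K`. -/
def evalCount {n : ℕ} (queries : ℕ → List (Query n)) (K : ℕ) : ℕ :=
  ∑ k ∈ Finset.range (K + 1), (queries k).length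

/-- The assumptions on the objective function for third-order models. (The lower bound that
is assumed for models of order `p` on the derivatives of order `3, …, p - 1` concerns no
derivative if `p = 3`.) -/
structure ObjectiveAssumptions {n : ℕ} (f : Vec n → ℝ) (flow L κ : ℝ) : Prop where
  smooth : ContDiff ℝ 3 f
  bounded_below : ∀ x, flow ≤ f x
  three_le : 3 ≤ L
  lipschitz : ∀ x y, ‖iteratedFDeriv ℝ 3 f x - iteratedFDeriv ℝ 3 f y‖ ≤ L * ‖x - y‖
  bounded_third : ∀ x, ‖iteratedFDeriv ℝ 3 f x‖ ≤ κ

/-- What the constants may depend on at the starting point: bounds on `f (x₀) - flow`, on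
`‖∇ f (x₀)‖` and on the negative curvature of `∇² f (x₀)`. -/
structure StartBounds {n : ℕ} (f : Vec n → ℝ) (flow : ℝ) (x₀ : Vec n) (Δ G B : ℝ) : Prop where
  gap : f x₀ - flow ≤ Δ
  grad : ‖gradient f x₀‖ ≤ G
  curv : max 0 (-lambdaMin (hessMatrix f x₀)) ≤ B

/-- `x` is an `(ε₁, ε₂)` approximate second-order stationary point of `f`. -/
def IsApproxSecondOrder {n : ℕ} (f : Vec n → ℝ) (ε₁ ε₂ : ℝ) (x : Vec n) : Prop :=
  ‖gradient f x‖ ≤ ε₁ ∧ -ε₂ ≤ lambdaMin (hessMatrix f x)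

end PSBThree

open PSBThree

/-!
Between two restarts the secant equation of the PSB update is satisfied exactly by the average
`H` of `∇³f` over the last step `s`. Minimality in the Frobenius norm forces
`T - H = (T_prev - H) ∘ (P, P, P)` with `P` the orthogonal projection onto `sᗮ`, so an update does
not increase the distance to `H` in the operator norm, which introduces no dependence on `n`, and
the error `‖T_k - ∇³f(x_k)‖` grows by at most `2L‖s‖`. With the error at the restart (zero, or
`√n L h_k` for finite differences, where the factor `√n` is cancelled by that in `h_k`) it is
bounded by `2L` times the length of the last `2m` steps.

With `μ_k` the length of `s_k` and of the `2m` steps before it, Taylor's formula then gives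
`f(x_{k+1}) - f(x_k) + σ_k‖s_k‖⁴/4! ≤ 2L μ_k⁴`, and bounds of order `μ_k³` and `μ_k²` on the
gradient and the negative curvature at `x_{k+1}`. Since `σ_k` accumulates `σ_j‖s_j‖⁴`, summing the
first inequality bounds `σ_k`: while `σ_k` is small, so are the steps and their sum of fourth
powers, and once it is large, its own growth absorbs the right-hand side. Hence `∑ μ_k⁴` is bounded
independently of `ε₁` and `ε₂`, whereas every iteration that does not reach an approximate
second-order point has `μ_k⁴` at least of order `min(ε₁^{4/3}, ε₂²)`.
-/

namespace PSBThree

open scoped NNReal ENNReal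

/-! ### Taylor polynomials -/

section TaylorPolynomial

variable {E F : Type*} [NormedAddCommGroup E] [NormedSpace ℝ E] [NormedAddCommGroup F]
  [NormedSpace ℝ F]

theorem comp_perm_of_comp_swap {α β : Type*} {p : ℕ} {A : (Fin (p + 1) → α) → β}
    (h : ∀ (i : Fin p) (v : Fin (p + 1) → α),
      A (fun j => v (Equiv.swap i.castSucc i.succ j)) = A v)
    (π : Equiv.Perm (Fin (p + 1))) (v : Fin (p + 1) → α) : A (fun j => v (π j)) = A v := by
  have hπ : π ∈ Submonoid.closure (Set.range fun i : Fin p => Equiv.swap i.castSucc i.succ) :=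
    Equiv.Perm.mclosure_swap_castSucc_succ p ▸ Submonoid.mem_top π
  induction hπ using Submonoid.closure_induction generalizing v with
  | mem _ hi => obtain ⟨i, rfl⟩ := hi; exact h i v
  | one => rfl
  | mul π₁ π₂ _ _ h₁ h₂ => exact (h₂ fun j => v (π₁ j)).trans (h₁ v)

theorem iteratedFDeriv_add_two_apply (f : E → F) {k : ℕ} (x : E) (v : Fin (k + 2) → E) :
    iteratedFDeriv ℝ (k + 2) f x v =
      fderiv ℝ (fderiv ℝ (iteratedFDeriv ℝ k f)) x (v 0) (v 1) (Fin.tail (Fin.tail v)) := by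
  have h := LinearIsometryEquiv.comp_fderiv (𝕜 := ℝ) (f := fderiv ℝ (iteratedFDeriv ℝ k f))
    (x := x) (continuousMultilinearCurryLeftEquiv ℝ (fun _ : Fin (k + 1) => E) F).symm
  exact DFunLike.congr_fun (DFunLike.congr_fun h (v 0)) (Fin.tail v)

theorem iteratedFDeriv_comp_swap_zero_one {f : E → F} {k : ℕ} (hf : ContDiff ℝ (k + 2 : ℕ) f)
    (x : E) (v : Fin (k + 2) → E) :
    iteratedFDeriv ℝ (k + 2) f x (fun j => v (Equiv.swap 0 1 j)) =
      iteratedFDeriv ℝ (k + 2) f x v := by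
  have hk : ContDiff ℝ 2 (iteratedFDeriv ℝ k f) :=
    hf.iteratedFDeriv_right (by norm_cast; omega)
  have hsymm := hk.contDiffAt (x := x) |>.isSymmSndFDerivAt (by simp)
  have htail : Fin.tail (Fin.tail fun j => v (Equiv.swap 0 1 j)) = Fin.tail (Fin.tail v) :=
    funext fun j => congrArg v (Equiv.swap_apply_of_ne_of_ne (Fin.succ_ne_zero _)
      ((Fin.succ_injective _).ne (Fin.succ_ne_zero j)))
  simp only [iteratedFDeriv_add_two_apply, htail, Equiv.swap_apply_left, Equiv.swap_apply_right]
  rw [hsymm.eq]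

theorem iteratedFDeriv_succ_tail_comp_perm {f : E → F} {k : ℕ} {π : Equiv.Perm (Fin k)}
    (hπ : ∀ y (v : Fin k → E),
      iteratedFDeriv ℝ k f y (fun j => v (π j)) = iteratedFDeriv ℝ k f y v) (x u : E)
    (v : Fin k → E) :
    iteratedFDeriv ℝ (k + 1) f x (Fin.cons u fun j => v (π j)) =
      iteratedFDeriv ℝ (k + 1) f x (Fin.cons u v) := by
  let P := ContinuousMultilinearMap.domDomCongrₗᵢ ℝ E F π
  have hP : P ∘ iteratedFDeriv ℝ k f = iteratedFDeriv ℝ k f := by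
    ext y w
    exact hπ y w
  have hP' : (P : _ →L[ℝ] _).comp (fderiv ℝ (iteratedFDeriv ℝ k f) x) =
      fderiv ℝ (iteratedFDeriv ℝ k f) x := by
    rw [← LinearIsometryEquiv.comp_fderiv, hP]
  exact DFunLike.congr_fun (DFunLike.congr_fun hP' u) v

theorem iteratedFDeriv_comp_perm {f : E → F} {k : ℕ} (hf : ContDiff ℝ k f) (x : E)
    (π : Equiv.Perm (Fin k)) (v : Fin k → E) :
    iteratedFDeriv ℝ k f x (fun j => v (π j)) = iteratedFDeriv ℝ k f x v := by
  induction k generalizing x with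
  | zero => exact congrArg _ (Subsingleton.elim _ _)
  | succ k ih =>
    refine comp_perm_of_comp_swap (fun i v => ?_) π v
    obtain _ | k := k
    · exact i.elim0
    cases i using Fin.cases with
    | zero => exact iteratedFDeriv_comp_swap_zero_one hf x v
    | succ i =>
      have hswap : (fun j => v (Equiv.swap i.succ.castSucc i.succ.succ j)) =
          Fin.cons (v 0) fun j => Fin.tail v (Equiv.swap i.castSucc i.succ j) := by
        refine funext (Fin.cases ?_ fun j => ?_)
        · exact congrArg v (Equiv.swap_apply_of_ne_of_ne (Fin.succ_ne_zero i.castSucc).symm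
            (Fin.succ_ne_zero i.succ).symm)
        · exact congrArg v ((Fin.succ_injective _).swap_apply i.castSucc i.succ j)
      rw [hswap, iteratedFDeriv_succ_tail_comp_perm
        (fun y w => ih (hf.of_le (by norm_cast; omega)) y _ w), Fin.cons_self_tail]

theorem exists_hasFiniteFPowerSeriesOnBall_iteratedFDeriv {f : E → F}
    {p : FormalMultilinearSeries ℝ E F} {x : E} {r : ℝ≥0∞} (n k : ℕ)
    (h : HasFiniteFPowerSeriesOnBall f p x (n + k) r) :
    ∃ q : FormalMultilinearSeries ℝ E (E [×k]→L[ℝ] F),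
      HasFiniteFPowerSeriesOnBall (iteratedFDeriv ℝ k f) q x n r := by
  induction k generalizing n with
  | zero =>
    exact ⟨_, ContinuousLinearMap.comp_hasFiniteFPowerSeriesOnBall
      ((continuousMultilinearCurryFin0 ℝ E F).symm : F →L[ℝ] E [×0]→L[ℝ] F) h⟩
  | succ k ih =>
    obtain ⟨q, hq⟩ := ih (n + 1) (by convert h using 1; ring)
    let uncurry : (E →L[ℝ] E [×k]→L[ℝ] F) →L[ℝ] E [×(k + 1)]→L[ℝ] F :=
      (continuousMultilinearCurryLeftEquiv ℝ (fun _ : Fin (k + 1) => E) F).symm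
        |>.toContinuousLinearEquiv
    have h' := ContinuousLinearMap.comp_hasFiniteFPowerSeriesOnBall (𝕜 := ℝ) uncurry hq.fderiv
    exact ⟨_, h'⟩

/-- The polynomial `s ↦ ∑_{i ≤ N} A_i[s]^i / i!`. It is the Taylor polynomial of `f` at `x` if
`A_i` is the `i`-th derivative of `f` at `x`, and its derivatives at `0` are the `A_i` if these
are symmetric. -/
noncomputable def taylorPolynomial (A : FormalMultilinearSeries ℝ E F) (N : ℕ) (s : E) : F :=
  ∑ i ∈ Finset.range (N + 1), (i.factorial : ℝ)⁻¹ • A i fun _ => s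

theorem hasFiniteFPowerSeriesOnBall_taylorPolynomial (A : FormalMultilinearSeries ℝ E F)
    (N : ℕ) :
    HasFiniteFPowerSeriesOnBall (taylorPolynomial A N)
      (fun i => if i ≤ N then (i.factorial : ℝ)⁻¹ • A i else 0) 0 (N + 1) ⊤ := by
  refine .mk' (fun i hi => if_neg (by omega)) ENNReal.zero_lt_top fun s _ => ?_
  rw [zero_add]
  refine Finset.sum_congr rfl fun i hi => ?_
  rw [if_pos (Finset.mem_range_succ_iff.1 hi)]
  rfl

theorem contDiff_taylorPolynomial (A : FormalMultilinearSeries ℝ E F) (N : ℕ)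
    {k : WithTop ℕ∞} : ContDiff ℝ k (taylorPolynomial A N) :=
  ContDiff.sum fun i _ =>
    ((A i).contDiff.comp (contDiff_pi.2 fun _ => contDiff_id)).const_smul _

theorem iteratedFDeriv_taylorPolynomial_zero [CompleteSpace F]
    {A : FormalMultilinearSeries ℝ E F} {N k : ℕ} (hk : k ≤ N)
    (hA : ∀ (π : Equiv.Perm (Fin k)) (v : Fin k → E), A k (fun i => v (π i)) = A k v) :
    iteratedFDeriv ℝ k (taylorPolynomial A N) 0 = A k := by
  ext v
  rw [(hasFiniteFPowerSeriesOnBall_taylorPolynomial A N).toHasFPowerSeriesOnBall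
    |>.iteratedFDeriv_eq_sum_of_completeSpace]
  simp only [if_pos hk, smul_apply, hA, Finset.sum_const, Finset.card_univ,
    Fintype.card_perm, Fintype.card_fin]
  rw [← Nat.cast_smul_eq_nsmul ℝ, smul_inv_smul₀ (by positivity)]

theorem iteratedFDeriv_taylorPolynomial_self [CompleteSpace F]
    {A : FormalMultilinearSeries ℝ E F} {N : ℕ}
    (hA : ∀ (π : Equiv.Perm (Fin N)) (v : Fin N → E), A N (fun i => v (π i)) = A N v) (s : E) :
    iteratedFDeriv ℝ N (taylorPolynomial A N) s = A N := by
  obtain ⟨q, hq⟩ := exists_hasFiniteFPowerSeriesOnBall_iteratedFDeriv 1 N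
    (add_comm N 1 ▸ hasFiniteFPowerSeriesOnBall_taylorPolynomial A N)
  rw [hq.eq_const_of_bound_one s (by simp),
    iteratedFDeriv_taylorPolynomial_zero le_rfl hA]

theorem norm_iteratedFDeriv_le_mul_pow {g : E → F} {N : ℕ} (hg : ContDiff ℝ N g)
    (h0 : ∀ k < N, iteratedFDeriv ℝ k g 0 = 0) {M r : ℝ}
    (hM : ∀ y, ‖y‖ ≤ r → ‖iteratedFDeriv ℝ N g y‖ ≤ M) (j k : ℕ) (hkj : k + j = N) (y : E)
    (hy : ‖y‖ ≤ r) : ‖iteratedFDeriv ℝ k g y‖ ≤ M * r ^ j := by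
  induction j generalizing k y with
  | zero =>
    obtain rfl : k = N := hkj
    simpa using hM y hy
  | succ j ih =>
    have hr : 0 ≤ r := (norm_nonneg y).trans hy
    have hMr : 0 ≤ M * r ^ j := (norm_nonneg _).trans (ih (k + 1) (by omega) y hy)
    have hd : Differentiable ℝ (iteratedFDeriv ℝ k g) :=
      hg.differentiable_iteratedFDeriv (by norm_cast; omega)
    have hmean := (convex_closedBall (0 : E) r).norm_image_sub_le_of_norm_fderiv_le
      (f := iteratedFDeriv ℝ k g) (C := M * r ^ j) (fun z _ => hd z)
      (fun z hz => by
        rw [norm_fderiv_iteratedFDeriv]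
        exact ih (k + 1) (by omega) z (by simpa using hz))
      (Metric.mem_closedBall_self hr) (mem_closedBall_zero_iff.2 hy)
    rw [h0 k (by omega), sub_zero, sub_zero] at hmean
    calc ‖iteratedFDeriv ℝ k g y‖ ≤ M * r ^ j * ‖y‖ := hmean
      _ ≤ M * r ^ j * r := by gcongr
      _ = M * r ^ (j + 1) := by ring

theorem norm_iteratedFDeriv_sub_taylorPolynomial_le [CompleteSpace F] {f : E → F} {N : ℕ}
    (hf : ContDiff ℝ N f) {L : ℝ≥0} (hL : LipschitzWith L (iteratedFDeriv ℝ N f)) {x : E}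
    {T : E [×N]→L[ℝ] F} (hT : ∀ (π : Equiv.Perm (Fin N)) v, T (fun i => v (π i)) = T v) (s : E)
    (j k : ℕ) (hkj : k + j = N) :
    ‖iteratedFDeriv ℝ k f (x + s)
        - iteratedFDeriv ℝ k (taylorPolynomial (Function.update (ftaylorSeries ℝ f x) N T) N) s‖
      ≤ (L * ‖s‖ + ‖T - iteratedFDeriv ℝ N f x‖) * ‖s‖ ^ j := by
  set A : FormalMultilinearSeries ℝ E F := Function.update (ftaylorSeries ℝ f x) N T
  have hfx : ContDiff ℝ N fun y => f (x + y) := hf.comp (contDiff_const.add contDiff_id)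
  have hq : ContDiff ℝ N (taylorPolynomial A N) := contDiff_taylorPolynomial A N
  have hsub : ∀ i ≤ N, ∀ y, iteratedFDeriv ℝ i (fun y => f (x + y) - taylorPolynomial A N y) y =
      iteratedFDeriv ℝ i f (x + y) - iteratedFDeriv ℝ i (taylorPolynomial A N) y := by
    intro i hi y
    have hi' : (i : WithTop ℕ∞) ≤ N := by exact_mod_cast hi
    rw [fun_iteratedFDeriv_sub_apply (hfx.of_le hi').contDiffAt (hq.of_le hi').contDiffAt,
      iteratedFDeriv_comp_add_left]
  have hAN : A N = T := Function.update_self ..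
  rw [← hsub k (by omega)]
  refine norm_iteratedFDeriv_le_mul_pow (hfx.sub hq) (fun i hi => ?_) (fun y hy => ?_) j k hkj s
    le_rfl
  · have hAi : A i = iteratedFDeriv ℝ i f x := Function.update_of_ne hi.ne ..
    have hi' : (i : WithTop ℕ∞) ≤ N := by exact_mod_cast hi.le
    rw [hsub i hi.le, iteratedFDeriv_taylorPolynomial_zero hi.le, hAi, add_zero, sub_self]
    rw [hAi]
    exact iteratedFDeriv_comp_perm (hf.of_le hi') x
  · rw [hsub N le_rfl, iteratedFDeriv_taylorPolynomial_self (hAN ▸ hT), hAN]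
    calc ‖iteratedFDeriv ℝ N f (x + y) - T‖
        ≤ ‖iteratedFDeriv ℝ N f (x + y) - iteratedFDeriv ℝ N f x‖
            + ‖iteratedFDeriv ℝ N f x - T‖ := norm_sub_le_norm_sub_add_norm_sub ..
      _ ≤ L * ‖y‖ + ‖T - iteratedFDeriv ℝ N f x‖ := by
        rw [norm_sub_rev _ T]
        gcongr
        simpa using hL.norm_sub_le (x + y) x
      _ ≤ L * ‖s‖ + ‖T - iteratedFDeriv ℝ N f x‖ := by gcongr

end TaylorPolynomial

theorem approxTaylor_eq_taylorPolynomial {n : ℕ} (f : Vec n → ℝ) (x : Vec n) (T : Tensor 3 n) :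
    approxTaylor f x T = taylorPolynomial (Function.update (ftaylorSeries ℝ f x) 3 T) 3 := by
  have hA : ∀ i ≠ 3, Function.update (ftaylorSeries ℝ f x) 3 T i = iteratedFDeriv ℝ i f x :=
    fun i hi => Function.update_of_ne hi ..
  have hT : Function.update (ftaylorSeries ℝ f x) 3 T 3 = T := Function.update_self ..
  funext s
  simp only [approxTaylor, taylorPolynomial, Finset.sum_range_succ, Finset.sum_range_zero,
    Finset.sum_Icc_succ_top (show 1 ≤ 1 + 1 by simp), Finset.Icc_self, Finset.sum_singleton,
    hA 0 (by simp), hA 1 (by simp), hA 2 (by simp), hT, iteratedFDeriv_zero_apply,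
    Nat.factorial_zero, smul_eq_mul]
  ring

theorem contDiff_approxTaylor {n : ℕ} (f : Vec n → ℝ) (x : Vec n) (T : Tensor 3 n)
    {k : WithTop ℕ∞} : ContDiff ℝ k (approxTaylor f x T) :=
  approxTaylor_eq_taylorPolynomial f x T ▸ contDiff_taylorPolynomial _ _

theorem norm_iteratedFDeriv_sub_approxTaylor_le {n : ℕ} {f : Vec n → ℝ} (hf : ContDiff ℝ 3 f)
    {L : ℝ≥0} (hL : LipschitzWith L (iteratedFDeriv ℝ 3 f)) {x : Vec n} {T : Tensor 3 n}
    (hT : IsSymmTensor T) {D ν : ℝ} (hLD : L ≤ D) (hν : 0 ≤ ν)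
    (hTν : ‖T - iteratedFDeriv ℝ 3 f x‖ ≤ D * ν) (s : Vec n) (j k : ℕ) (hkj : k + j = 3) :
    ‖iteratedFDeriv ℝ k f (x + s) - iteratedFDeriv ℝ k (approxTaylor f x T) s‖
      ≤ D * (‖s‖ + ν) ^ (j + 1) := by
  rw [approxTaylor_eq_taylorPolynomial]
  have hD : 0 ≤ D := L.coe_nonneg.trans hLD
  calc ‖_‖ ≤ (L * ‖s‖ + ‖T - iteratedFDeriv ℝ 3 f x‖) * ‖s‖ ^ j :=
        norm_iteratedFDeriv_sub_taylorPolynomial_le hf hL hT s j k hkj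
    _ ≤ (D * ‖s‖ + D * ν) * (‖s‖ + ν) ^ j := by
      gcongr
      exact le_add_of_nonneg_right hν
    _ = D * (‖s‖ + ν) ^ (j + 1) := by ring

/-! ### The leftmost eigenvalue of the Hessian -/

theorem sum_smul_basisVec {n : ℕ} (v : Vec n) : ∑ i, v i • basisVec i = v := by
  simpa [basisVec] using (EuclideanSpace.basisFun (Fin n) ℝ).sum_repr v

theorem dotProduct_hessMatrix_mulVec {n : ℕ} (f : Vec n → ℝ) (x v : Vec n) :
    v.ofLp ⬝ᵥ (hessMatrix f x).mulVec v.ofLp = iteratedFDeriv ℝ 2 f x fun _ => v := by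
  conv_rhs => rw [← sum_smul_basisVec v]
  rw [iteratedFDeriv_two_apply]
  simp only [dotProduct, Matrix.mulVec, hessMatrix, Matrix.of_apply, iteratedFDeriv_two_apply,
    map_sum, map_smul, sum_apply, smul_apply, Matrix.cons_val_zero,
    Matrix.cons_val_one, smul_eq_mul, Finset.mul_sum]
  rw [Finset.sum_comm]
  exact Finset.sum_congr rfl fun i _ => Finset.sum_congr rfl fun j _ => by ring

theorem isHermitian_hessMatrix {n : ℕ} {f : Vec n → ℝ} (hf : ContDiff ℝ 2 f) (x : Vec n) :
    (hessMatrix f x).IsHermitian := by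
  ext i j
  simp only [hessMatrix, Matrix.conjTranspose_apply, Matrix.of_apply, star_trivial]
  rw [← iteratedFDeriv_comp_perm hf x (Equiv.swap 0 1)]
  congr 1
  funext k
  fin_cases k <;> rfl

theorem le_lambdaMin_iff {n : ℕ} [NeZero n] {A : Matrix (Fin n) (Fin n) ℝ}
    (hA : A.IsHermitian) {c : ℝ} :
    c ≤ lambdaMin A ↔ ∀ v : Vec n, c * ‖v‖ ^ 2 ≤ v.ofLp ⬝ᵥ A.mulVec v.ofLp := by
  have hne : (spectrum ℝ A).Nonempty := ⟨_, hA.eigenvalues_mem_spectrum_real 0⟩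
  have hB : (A - algebraMap ℝ (Matrix (Fin n) (Fin n) ℝ) c).IsHermitian :=
    hA.sub (by simp [Matrix.algebraMap_eq_diagonal, Matrix.IsHermitian])
  have hpsd : c ≤ lambdaMin A ↔ (A - algebraMap ℝ (Matrix (Fin n) (Fin n) ℝ) c).PosSemidef := by
    rw [lambdaMin, le_csInf_iff A.finite_real_spectrum.bddBelow hne,
      Matrix.posSemidef_iff_isHermitian_and_spectrum_nonneg, and_iff_right hB,
      ← spectrum.sub_singleton_eq]
    simp [Set.subset_def]
  rw [hpsd, Matrix.posSemidef_iff_dotProduct_mulVec, and_iff_right hB,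
    ← (WithLp.equiv 2 (Fin n → ℝ)).forall_congr_right]
  refine forall_congr' fun v => ?_
  have hv : ‖v‖ ^ 2 = v.ofLp ⬝ᵥ v.ofLp := by
    rw [EuclideanSpace.real_norm_sq_eq]
    simp only [dotProduct, pow_two]
  simp [hv, Algebra.algebraMap_eq_smul_one, Matrix.sub_mulVec, Matrix.smul_mulVec]

theorem le_lambdaMin_hessMatrix_iff {n : ℕ} [NeZero n] {f : Vec n → ℝ} (hf : ContDiff ℝ 2 f)
    {x : Vec n} {c : ℝ} :
    c ≤ lambdaMin (hessMatrix f x) ↔ ∀ v, c * ‖v‖ ^ 2 ≤ iteratedFDeriv ℝ 2 f x fun _ => v := by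
  simp only [le_lambdaMin_iff (isHermitian_hessMatrix hf x), dotProduct_hessMatrix_mulVec]

theorem lambdaMin_hessMatrix_le_add {n : ℕ} [NeZero n] {f g : Vec n → ℝ} (hf : ContDiff ℝ 2 f)
    (hg : ContDiff ℝ 2 g) (x y : Vec n) :
    lambdaMin (hessMatrix g y) ≤
      lambdaMin (hessMatrix f x) + ‖iteratedFDeriv ℝ 2 f x - iteratedFDeriv ℝ 2 g y‖ := by
  rw [← sub_le_iff_le_add, le_lambdaMin_hessMatrix_iff hf]
  intro v
  have hv := (le_lambdaMin_hessMatrix_iff hg).1 (le_refl (lambdaMin (hessMatrix g y))) v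
  have hfg := (iteratedFDeriv ℝ 2 f x - iteratedFDeriv ℝ 2 g y).le_opNorm fun _ => v
  rw [Finset.prod_const, Finset.card_fin, sub_apply, Real.norm_eq_abs, abs_le] at hfg
  linarith

theorem norm_gradient_eq {E : Type*} [NormedAddCommGroup E] [InnerProductSpace ℝ E]
    [CompleteSpace E] (f : E → ℝ) (x : E) : ‖gradient f x‖ = ‖iteratedFDeriv ℝ 1 f x‖ := by
  rw [gradient, LinearIsometryEquiv.norm_map, norm_iteratedFDeriv_one]

/-! ### The Frobenius norm and the secant update -/

/-- The array of the entries of a tensor in the canonical basis, as a vector whose Euclidean norm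
is `frobNorm`. -/
noncomputable def entries {p n : ℕ} : Tensor p n →ₗ[ℝ] EuclideanSpace ℝ (Fin p → Fin n) where
  toFun T := WithLp.toLp 2 fun i => T fun j => basisVec (i j)
  map_add' _ _ := rfl
  map_smul' _ _ := rfl

theorem frobNorm_eq_norm_entries {p n : ℕ} (T : Tensor p n) : frobNorm T = ‖entries T‖ := by
  simp only [EuclideanSpace.norm_eq, Real.norm_eq_abs, sq_abs]
  rfl

theorem apply_eq_sum_entries {p n : ℕ} (T : Tensor p n) (v : Fin p → Vec n) :
    T v = ∑ i, (∏ j, v j (i j)) * entries T i := by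
  conv_lhs => rw [← funext fun j => sum_smul_basisVec (v j)]
  rw [T.map_sum]
  exact Finset.sum_congr rfl fun i _ => T.map_smul_univ (fun j => v j (i j)) fun j => basisVec (i j)

theorem entries_injective {p n : ℕ} : Function.Injective (entries (p := p) (n := n)) :=
  fun A B h => by
    ext v
    rw [apply_eq_sum_entries, h, ← apply_eq_sum_entries]

theorem inner_entries_compContinuousLinearMap {p n : ℕ} (A B : Tensor p n)
    (P : Vec n →L[ℝ] Vec n) :
    inner ℝ (entries (A.compContinuousLinearMap fun _ => P)) (entries B) =
      inner ℝ (entries A) (entries (B.compContinuousLinearMap fun _ => P.adjoint)) := by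
  have hadj : ∀ i j, P (basisVec i) j = P.adjoint (basisVec j) i := fun i j => by
    simpa [basisVec, EuclideanSpace.inner_single_left, EuclideanSpace.inner_single_right]
      using (P.adjoint_inner_left (basisVec i) (basisVec j)).symm
  have hentries : ∀ (C : Tensor p n) (Q : Vec n →L[ℝ] Vec n) i,
      entries (C.compContinuousLinearMap fun _ => Q) i =
        ∑ r, (∏ j, Q (basisVec (i j)) (r j)) * entries C r := fun C Q i =>
    apply_eq_sum_entries C fun j => Q (basisVec (i j))
  simp only [PiLp.inner_apply, hentries, hadj, RCLike.inner_apply, conj_trivial, Finset.mul_sum,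
    Finset.sum_mul]
  rw [Finset.sum_comm]
  exact Finset.sum_congr rfl fun r _ => Finset.sum_congr rfl fun i _ => by ring

theorem eq_comp_starProjection_of_frobNorm_sub_le {p n : ℕ} {K : Submodule ℝ (Vec n)}
    {A D : Tensor p n} (hD : D.compContinuousLinearMap (fun _ => K.starProjection) = D)
    (hle : frobNorm (D - A) ≤
      frobNorm (A.compContinuousLinearMap (fun _ => K.starProjection) - A)) :
    D = A.compContinuousLinearMap fun _ => K.starProjection := by
  set A' := A.compContinuousLinearMap fun _ => K.starProjection with hA'
  have hker : (A' - A).compContinuousLinearMap (fun _ => K.starProjection) = 0 := by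
    ext v
    simp [hA', Submodule.starProjection_eq_self_iff.2 (K.starProjection_apply_mem _)]
  have hfix : (D - A').compContinuousLinearMap (fun _ => K.starProjection) = D - A' := by
    conv_rhs => rw [← hD]
    ext v
    simp [hA', Submodule.starProjection_eq_self_iff.2 (K.starProjection_apply_mem _)]
  have horth : inner ℝ (entries (D - A')) (entries (A' - A)) = (0 : ℝ) := by
    rw [← hfix, inner_entries_compContinuousLinearMap,
      (isSelfAdjoint_starProjection K).adjoint_eq, hker, map_zero, inner_zero_right]
  have hpyth := norm_add_sq_eq_norm_sq_add_norm_sq_real horth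
  rw [← map_add, sub_add_sub_cancel] at hpyth
  simp only [frobNorm_eq_norm_entries] at hle
  have hsq := mul_self_le_mul_self (norm_nonneg _) hle
  have hzero : ‖entries (D - A')‖ * ‖entries (D - A')‖ = 0 :=
    le_antisymm (by linarith) (mul_self_nonneg _)
  rw [mul_self_eq_zero, norm_eq_zero, map_sub, sub_eq_zero] at hzero
  exact entries_injective hzero

theorem IsSymmTensor.add {p n : ℕ} {A B : Tensor p n} (hA : IsSymmTensor A)
    (hB : IsSymmTensor B) : IsSymmTensor (A + B) := fun π v => by
  rw [add_apply, add_apply, hA π v, hB π v]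

theorem IsSymmTensor.sub {p n : ℕ} {A B : Tensor p n} (hA : IsSymmTensor A)
    (hB : IsSymmTensor B) : IsSymmTensor (A - B) := fun π v => by
  rw [sub_apply, sub_apply, hA π v, hB π v]

theorem IsSymmTensor.compContinuousLinearMap {p n : ℕ} {A : Tensor p n} (hA : IsSymmTensor A)
    (P : Vec n →L[ℝ] Vec n) : IsSymmTensor (A.compContinuousLinearMap fun _ => P) :=
  fun π v => hA π fun j => P (v j)

theorem IsSymmTensor.apply_eq_zero_of_mem_span {p n : ℕ} {A : Tensor (p + 1) n}
    (hA : IsSymmTensor A) {s : Vec n} (hs : A.curryLeft s = 0) {v : Fin (p + 1) → Vec n}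
    {a : Fin (p + 1)} (hv : v a ∈ Submodule.span ℝ {s}) : A v = 0 := by
  obtain ⟨c, hc⟩ := Submodule.mem_span_singleton.1 hv
  rw [← hA (Equiv.swap 0 a) v, ← Fin.cons_self_tail (fun i => v (Equiv.swap 0 a i)),
    Equiv.swap_apply_left, ← hc, ← A.curryLeft_apply, map_smul, hs, smul_zero, zero_apply]

theorem IsSymmTensor.comp_starProjection_eq_self {p n : ℕ} {A : Tensor (p + 1) n}
    (hA : IsSymmTensor A) {s : Vec n} (hs : A.curryLeft s = 0) :
    A.compContinuousLinearMap (fun _ => (Submodule.span ℝ {s})ᗮ.starProjection) = A := by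
  ext v
  set P := (Submodule.span ℝ {s})ᗮ.starProjection
  have hspan : ∀ u, u - P u ∈ Submodule.span ℝ {s} := fun u => by
    simpa only [Submodule.orthogonal_orthogonal] using
      (Submodule.span ℝ {s})ᗮ.sub_starProjection_mem_orthogonal u
  have hsplit : v = (fun j => P (v j)) + fun j => v j - P (v j) := by
    funext j
    simp
  have hexpand := A.toMultilinearMap.map_add_univ (fun j => P (v j)) fun j => v j - P (v j)
  rw [← hsplit, Finset.sum_eq_single Finset.univ, Finset.piecewise_univ] at hexpand
  · exact hexpand.symm
  · intro S _ hS
    obtain ⟨a, ha⟩ : ∃ a, a ∉ S := by simpa [Finset.eq_univ_iff_forall] using hS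
    exact hA.apply_eq_zero_of_mem_span hs (a := a) (by simpa [ha] using hspan (v a))
  · simp

theorem IsPSBUpdate.sub_eq {n : ℕ} {Tprev T H : Tensor 3 n} {s : Vec n} {Y : Tensor 2 n}
    (hT : IsPSBUpdate Tprev s Y T) (hprev : IsSymmTensor Tprev) (hH : H ∈ secantSet s Y) :
    T - H = (Tprev - H).compContinuousLinearMap
      fun _ => (Submodule.span ℝ {s})ᗮ.starProjection := by
  set P := (Submodule.span ℝ {s})ᗮ.starProjection with hP
  set E := (Tprev - H).compContinuousLinearMap fun _ => P
  have hPs : P s = 0 := by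
    rw [hP, Submodule.starProjection_apply_eq_zero_iff, Submodule.orthogonal_orthogonal]
    exact Submodule.mem_span_singleton_self s
  have hEs : E.curryLeft s = 0 := by
    ext v
    exact (Tprev - H).map_coord_zero 0 hPs
  have hmem : H + E ∈ secantSet s Y :=
    ⟨hH.1.add ((hprev.sub hH.1).compContinuousLinearMap P),
      (congrArg₂ (· + ·) hH.2 hEs).trans (add_zero Y)⟩
  have hTs : (T - H).curryLeft s = 0 := sub_eq_zero.2 (hT.1.2.trans hH.2.symm)
  refine eq_comp_starProjection_of_frobNorm_sub_le
    ((hT.1.1.sub hH.1).comp_starProjection_eq_self hTs) ?_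
  rw [sub_sub_sub_cancel_right, show E - (Tprev - H) = H + E - Tprev by abel]
  exact hT.2 _ hmem

theorem IsPSBUpdate.norm_sub_le {n : ℕ} {Tprev T H : Tensor 3 n} {s : Vec n} {Y : Tensor 2 n}
    (hT : IsPSBUpdate Tprev s Y T) (hprev : IsSymmTensor Tprev) (hH : H ∈ secantSet s Y) :
    ‖T - H‖ ≤ ‖Tprev - H‖ := by
  rw [hT.sub_eq hprev hH]
  refine ((Tprev - H).norm_compContinuousLinearMap_le _).trans
    (mul_le_of_le_one_right (norm_nonneg _) ?_)
  exact Finset.prod_le_one (fun _ _ => norm_nonneg _) fun _ _ => Submodule.starProjection_norm_le _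

/-! ### Averaged derivatives -/

section MeanDerivative

variable {E F : Type*} [NormedAddCommGroup E] [NormedSpace ℝ E] [NormedAddCommGroup F]
  [NormedSpace ℝ F]

/-- The average of `∇^k f` over the segment from `x` to `x + s`. For `k = 3` it satisfies exactly
the secant equation that defines the PSB update. -/
noncomputable def meanIteratedFDeriv (f : E → F) (k : ℕ) (x s : E) : E [×k]→L[ℝ] F :=
  ∫ t in (0 : ℝ)..1, iteratedFDeriv ℝ k f (x + t • s)

theorem continuous_iteratedFDeriv_segment {f : E → F} {k : ℕ} (hf : ContDiff ℝ k f) (x s : E) :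
    Continuous fun t : ℝ => iteratedFDeriv ℝ k f (x + t • s) :=
  (hf.continuous_iteratedFDeriv le_rfl).comp (by fun_prop)

theorem meanIteratedFDeriv_apply [CompleteSpace F] {f : E → F} {k : ℕ} (hf : ContDiff ℝ k f)
    (x s : E) (v : Fin k → E) :
    meanIteratedFDeriv f k x s v = ∫ t in (0 : ℝ)..1, iteratedFDeriv ℝ k f (x + t • s) v :=
  ((ContinuousMultilinearMap.apply ℝ (fun _ : Fin k => E) F v).intervalIntegral_comp_comm
    ((continuous_iteratedFDeriv_segment hf x s).intervalIntegrable 0 1)).symm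

theorem meanIteratedFDeriv_comp_perm [CompleteSpace F] {f : E → F} {k : ℕ} (hf : ContDiff ℝ k f)
    (x s : E) (π : Equiv.Perm (Fin k)) (v : Fin k → E) :
    meanIteratedFDeriv f k x s (fun j => v (π j)) = meanIteratedFDeriv f k x s v := by
  simp only [meanIteratedFDeriv_apply hf, iteratedFDeriv_comp_perm hf]

theorem curryLeft_meanIteratedFDeriv [CompleteSpace F] {f : E → F} {k : ℕ}
    (hf : ContDiff ℝ (k + 1 : ℕ) f) (x s : E) :
    (meanIteratedFDeriv f (k + 1) x s).curryLeft s =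
      iteratedFDeriv ℝ k f (x + s) - iteratedFDeriv ℝ k f x := by
  have hderiv : ∀ t : ℝ, HasDerivAt (fun t : ℝ => iteratedFDeriv ℝ k f (x + t • s))
      ((iteratedFDeriv ℝ (k + 1) f (x + t • s)).curryLeft s) t := fun t =>
    (hf.differentiable_iteratedFDeriv (Nat.cast_lt.2 k.lt_succ_self) _).hasFDerivAt.comp_hasDerivAt
      t (by simpa using ((hasDerivAt_id t).smul_const s).const_add x)
  ext v
  have hftc := intervalIntegral.integral_eq_sub_of_hasDerivAt (fun t _ =>
    (ContinuousMultilinearMap.apply ℝ (fun _ : Fin k => E) F v).hasFDerivAt.comp_hasDerivAt t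
      (hderiv t))
    (((continuous_eval_const (Fin.cons s v : Fin (k + 1) → E)).comp
      (continuous_iteratedFDeriv_segment hf x s)).intervalIntegrable 0 1)
  rw [ContinuousMultilinearMap.curryLeft_apply, meanIteratedFDeriv_apply hf]
  simpa using hftc

theorem norm_meanIteratedFDeriv_sub_le [CompleteSpace F] {f : E → F} {k : ℕ}
    (hf : ContDiff ℝ k f) {L : ℝ≥0} (hL : LipschitzWith L (iteratedFDeriv ℝ k f)) (x s : E)
    {r : ℝ} (hr : r ∈ Set.Icc (0 : ℝ) 1) :
    ‖meanIteratedFDeriv f k x s - iteratedFDeriv ℝ k f (x + r • s)‖ ≤ L * ‖s‖ := by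
  have hsub : meanIteratedFDeriv f k x s - iteratedFDeriv ℝ k f (x + r • s) =
      ∫ t in (0 : ℝ)..1,
        (iteratedFDeriv ℝ k f (x + t • s) - iteratedFDeriv ℝ k f (x + r • s)) := by
    rw [intervalIntegral.integral_sub
      ((continuous_iteratedFDeriv_segment hf x s).intervalIntegrable 0 1)
      intervalIntegrable_const, intervalIntegral.integral_const, sub_zero, one_smul,
      meanIteratedFDeriv]
  have hbound : ∀ t ∈ Set.uIoc (0 : ℝ) 1,
      ‖iteratedFDeriv ℝ k f (x + t • s) - iteratedFDeriv ℝ k f (x + r • s)‖ ≤ L * ‖s‖ := by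
    intro t ht
    rw [Set.uIoc_of_le zero_le_one] at ht
    refine (hL.norm_sub_le _ _).trans ?_
    rw [add_sub_add_left_eq_sub, ← sub_smul, norm_smul, Real.norm_eq_abs]
    have htr : |t - r| ≤ 1 := abs_le.2 ⟨by linarith [ht.1, hr.2], by linarith [ht.2, hr.1]⟩
    gcongr
    exact mul_le_of_le_one_left (norm_nonneg s) htr
  rw [hsub]
  simpa using intervalIntegral.norm_integral_le_of_norm_le_const hbound

theorem norm_iteratedFDeriv_sub_sub_curryLeft_le [CompleteSpace F] {f : E → F} {k : ℕ}
    (hf : ContDiff ℝ (k + 1 : ℕ) f) {L : ℝ≥0} (hL : LipschitzWith L (iteratedFDeriv ℝ (k + 1) f))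
    (x s : E) :
    ‖iteratedFDeriv ℝ k f (x + s) - iteratedFDeriv ℝ k f x -
      (iteratedFDeriv ℝ (k + 1) f x).curryLeft s‖ ≤ L * ‖s‖ ^ 2 := by
  have hmean := norm_meanIteratedFDeriv_sub_le hf hL x s ⟨le_rfl, zero_le_one⟩
  rw [zero_smul, add_zero] at hmean
  rw [← curryLeft_meanIteratedFDeriv hf]
  calc _ = ‖(meanIteratedFDeriv f (k + 1) x s - iteratedFDeriv ℝ (k + 1) f x).curryLeft s‖ := rfl
    _ ≤ ‖meanIteratedFDeriv f (k + 1) x s - iteratedFDeriv ℝ (k + 1) f x‖ * ‖s‖ := by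
      simpa only [ContinuousMultilinearMap.curryLeft_norm] using
        (meanIteratedFDeriv f (k + 1) x s - iteratedFDeriv ℝ (k + 1) f x).curryLeft.le_opNorm s
    _ ≤ L * ‖s‖ * ‖s‖ := by gcongr
    _ = L * ‖s‖ ^ 2 := by ring

end MeanDerivative

theorem IsPSBUpdate.norm_sub_iteratedFDeriv_le {n : ℕ} {f : Vec n → ℝ} (hf : ContDiff ℝ 3 f)
    {L : ℝ≥0} (hL : LipschitzWith L (iteratedFDeriv ℝ 3 f)) {x s : Vec n} {Tprev T : Tensor 3 n}
    (hT : IsPSBUpdate Tprev s (iteratedFDeriv ℝ 2 f (x + s) - iteratedFDeriv ℝ 2 f x) T)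
    (hprev : IsSymmTensor Tprev) :
    ‖T - iteratedFDeriv ℝ 3 f (x + s)‖ ≤
      ‖Tprev - iteratedFDeriv ℝ 3 f x‖ + 2 * L * ‖s‖ := by
  set H := meanIteratedFDeriv f 3 x s
  have hupdate : ‖T - H‖ ≤ ‖Tprev - H‖ :=
    hT.norm_sub_le hprev ⟨meanIteratedFDeriv_comp_perm hf x s, curryLeft_meanIteratedFDeriv hf x s⟩
  have hleft : ‖H - iteratedFDeriv ℝ 3 f x‖ ≤ L * ‖s‖ := by
    simpa using norm_meanIteratedFDeriv_sub_le hf hL x s ⟨le_rfl, zero_le_one⟩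
  have hright : ‖H - iteratedFDeriv ℝ 3 f (x + s)‖ ≤ L * ‖s‖ := by
    simpa using norm_meanIteratedFDeriv_sub_le hf hL x s ⟨zero_le_one, le_rfl⟩
  calc ‖T - iteratedFDeriv ℝ 3 f (x + s)‖
      ≤ ‖T - H‖ + ‖H - iteratedFDeriv ℝ 3 f (x + s)‖ := norm_sub_le_norm_sub_add_norm_sub _ _ _
    _ ≤ ‖Tprev - H‖ + L * ‖s‖ := add_le_add hupdate hright
    _ ≤ ‖Tprev - iteratedFDeriv ℝ 3 f x‖ + ‖H - iteratedFDeriv ℝ 3 f x‖ + L * ‖s‖ := by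
      gcongr
      rw [norm_sub_rev H]
      exact norm_sub_le_norm_sub_add_norm_sub _ _ _
    _ ≤ ‖Tprev - iteratedFDeriv ℝ 3 f x‖ + 2 * L * ‖s‖ := by linarith

/-! ### The finite-difference tensor -/

theorem isSymmTensor_symProj {p n : ℕ} (T : Tensor p n) : IsSymmTensor (symProj T) := by
  intro π v
  rw [symProj_apply, symProj_apply]
  congr 1
  exact Fintype.sum_equiv (Equiv.mulLeft π) _ _ fun τ => rfl

theorem IsSymmTensor.symProj_eq {p n : ℕ} {T : Tensor p n} (hT : IsSymmTensor T) :
    symProj T = T := by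
  ext v
  simp [symProj_apply, hT _ v, Fintype.card_perm, Nat.factorial_ne_zero]

theorem symProj_sub {p n : ℕ} (A B : Tensor p n) : symProj (A - B) = symProj A - symProj B := by
  ext v
  simp only [symProj_apply, sub_apply, Finset.sum_sub_distrib, mul_sub]

theorem norm_symProj_le {p n : ℕ} (T : Tensor p n) : ‖symProj T‖ ≤ ‖T‖ := by
  rw [symProj, norm_smul, norm_inv, Real.norm_natCast]
  calc _ ≤ (Nat.factorial p : ℝ)⁻¹ * ∑ _π : Equiv.Perm (Fin p), ‖T‖ := by
        gcongr
        refine (norm_sum_le _ _).trans (Finset.sum_le_sum fun π _ => ?_)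
        exact (ContinuousMultilinearMap.norm_domDomCongr ℝ (Vec n) ℝ π T).le
    _ = ‖T‖ := by
        simp [Fintype.card_perm, Nat.factorial_ne_zero]

theorem sum_abs_le_sqrt_mul_norm {n : ℕ} (v : Vec n) : ∑ i, |v i| ≤ √n * ‖v‖ := by
  rw [EuclideanSpace.norm_eq, ← Real.sqrt_mul (Nat.cast_nonneg n)]
  refine Real.le_sqrt_of_sq_le ?_
  simpa using sq_sum_le_card_mul_sum_sq (s := Finset.univ) (f := fun i => |v i|)

theorem outer_sub {p n : ℕ} (S S' : Tensor p n) (u : Vec n) :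
    outer (S - S') u = outer S u - outer S' u := by
  ext v
  simp only [outer_apply, sub_apply, sub_mul]

theorem outer_basisVec_apply {p n : ℕ} (S : Tensor p n) (i : Fin n) (v : Fin (p + 1) → Vec n) :
    outer S (basisVec i) v = S (fun j => v j.castSucc) * v (Fin.last p) i := by
  simp [outer_apply, basisVec, EuclideanSpace.inner_single_left]

theorem norm_sum_outer_basisVec_le {p n : ℕ} {S : Fin n → Tensor p n} {C : ℝ} (hC : 0 ≤ C)
    (hS : ∀ i, ‖S i‖ ≤ C) : ‖∑ i, outer (S i) (basisVec i)‖ ≤ √n * C := by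
  refine ContinuousMultilinearMap.opNorm_le_bound (by positivity) fun v => ?_
  simp only [sum_apply, outer_basisVec_apply, Real.norm_eq_abs]
  calc |∑ i, S i (fun j => v j.castSucc) * v (Fin.last p) i|
      ≤ ∑ i, |S i (fun j => v j.castSucc)| * |v (Fin.last p) i| := by
        simpa only [abs_mul] using Finset.abs_sum_le_sum_abs
          (fun i => S i (fun j => v j.castSucc) * v (Fin.last p) i) Finset.univ
    _ ≤ ∑ i, (C * ∏ j : Fin p, ‖v j.castSucc‖) * |v (Fin.last p) i| := by
        gcongr with i
        exact ((S i).le_opNorm _).trans (by gcongr; exact hS i)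
    _ ≤ (C * ∏ j : Fin p, ‖v j.castSucc‖) * (√n * ‖v (Fin.last p)‖) := by
        rw [← Finset.mul_sum]
        gcongr
        exact sum_abs_le_sqrt_mul_norm _
    _ = √n * C * ∏ j, ‖v j‖ := by
        rw [Fin.prod_univ_castSucc]
        ring

theorem IsSymmTensor.sum_outer_curryLeft_basisVec {p n : ℕ} {A : Tensor (p + 1) n}
    (hA : IsSymmTensor A) : ∑ i, outer (A.curryLeft (basisVec i)) (basisVec i) = A := by
  ext v
  have hrot : A v = A.curryLeft (v (Fin.last p)) fun j => v j.castSucc := by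
    rw [← hA (finRotate (p + 1)).symm v, A.curryLeft_apply]
    congr 1
    funext j
    refine Fin.cases ?_ (fun j => ?_) j
    · rw [Fin.cons_zero, ← finRotate_last, Equiv.symm_apply_apply]
    · rw [Fin.cons_succ, ← Fin.coeSucc_eq_succ, ← finRotate_apply, Equiv.symm_apply_apply]
  rw [hrot]
  conv_rhs => rw [← sum_smul_basisVec (v (Fin.last p))]
  simp only [sum_apply, outer_basisVec_apply, map_sum, map_smul, smul_apply, smul_eq_mul, mul_comm]

theorem norm_fdTensor_sub_le {n : ℕ} {f : Vec n → ℝ} (hf : ContDiff ℝ 3 f) {L : ℝ≥0}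
    (hL : LipschitzWith L (iteratedFDeriv ℝ 3 f)) (x : Vec n) {h : ℝ} (hh : 0 < h) :
    ‖fdTensor f x h - iteratedFDeriv ℝ 3 f x‖ ≤ √n * (L * h) := by
  have hquot : ∀ i : Fin n, ‖h⁻¹ • (iteratedFDeriv ℝ 2 f (x + h • basisVec i) -
      iteratedFDeriv ℝ 2 f x) - (iteratedFDeriv ℝ 3 f x).curryLeft (basisVec i)‖ ≤ L * h := by
    intro i
    have hnorm : ‖h • (basisVec i : Vec n)‖ = h := by
      simp [norm_smul, basisVec, hh.le]
    have hrem := norm_iteratedFDeriv_sub_sub_curryLeft_le (k := 2) hf hL x (h • basisVec i)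
    rw [hnorm, map_smul] at hrem
    rw [← inv_smul_smul₀ hh.ne' ((iteratedFDeriv ℝ 3 f x).curryLeft (basisVec i)), ← smul_sub,
      norm_smul, norm_inv, Real.norm_of_nonneg hh.le, inv_mul_le_iff₀ hh]
    linarith
  have hsymm : IsSymmTensor (iteratedFDeriv ℝ 3 f x) := iteratedFDeriv_comp_perm hf x
  conv_lhs => rw [← hsymm.sum_outer_curryLeft_basisVec]
  rw [fdTensor, ← Finset.sum_sub_distrib]
  simp only [← outer_sub]
  exact norm_sum_outer_basisVec_le (by positivity) hquot

theorem norm_symProj_fdTensor_sub_le {n : ℕ} {f : Vec n → ℝ} (hf : ContDiff ℝ 3 f) {L : ℝ≥0}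
    (hL : LipschitzWith L (iteratedFDeriv ℝ 3 f)) (x : Vec n) {h : ℝ} (hh : 0 < h) :
    ‖symProj (fdTensor f x h) - iteratedFDeriv ℝ 3 f x‖ ≤ √n * (L * h) := by
  have hsymm : IsSymmTensor (iteratedFDeriv ℝ 3 f x) := iteratedFDeriv_comp_perm hf x
  rw [← hsymm.symProj_eq, ← symProj_sub]
  exact (norm_symProj_le _).trans (norm_fdTensor_sub_le hf hL x hh)

/-! ### The scalar recursion of step lengths and regularization parameters -/

section PastSteps

/-- The length `a (k - i)` of the step made `i` iterations before iteration `k`, with the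
convention that the steps before iteration `0` have length `1`. -/
noncomputable def pastLength (a : ℕ → ℝ) (k i : ℕ) : ℝ := if i ≤ k then a (k - i) else 1

/-- The total length of the `p` steps made before iteration `k`. It controls the error of the
third-order tensor used at iteration `k`. -/
noncomputable def pastSum (a : ℕ → ℝ) (p k : ℕ) : ℝ :=
  ∑ i ∈ Finset.range p, pastLength a k (i + 1)

variable {a : ℕ → ℝ}

theorem pastLength_zero (a : ℕ → ℝ) (k : ℕ) : pastLength a k 0 = a k := by
  simp [pastLength]

theorem pastLength_succ_succ (a : ℕ → ℝ) (k i : ℕ) :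
    pastLength a (k + 1) (i + 1) = pastLength a k i := by
  simp [pastLength]

theorem pastLength_of_lt (a : ℕ → ℝ) {k i : ℕ} (h : k < i) : pastLength a k i = 1 :=
  if_neg h.not_ge

theorem pastLength_nonneg (ha : ∀ k, 0 ≤ a k) (k i : ℕ) : 0 ≤ pastLength a k i := by
  unfold pastLength
  split_ifs <;> simp [ha]

theorem pastSum_nonneg (ha : ∀ k, 0 ≤ a k) (p k : ℕ) : 0 ≤ pastSum a p k :=
  Finset.sum_nonneg fun _ _ => pastLength_nonneg ha _ _

theorem pastSum_pos (ha : ∀ k, 0 ≤ a k) {p k : ℕ} (hp : 1 ≤ p) (hk : ∀ j < k, 0 < a j) :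
    0 < pastSum a p k := by
  refine Finset.sum_pos' (fun _ _ => pastLength_nonneg ha _ _) ⟨0, Finset.mem_range.2 hp, ?_⟩
  unfold pastLength
  split_ifs with h
  · exact hk _ (by omega)
  · exact one_pos

theorem pastSum_mono (ha : ∀ k, 0 ≤ a k) {p q : ℕ} (h : p ≤ q) (k : ℕ) :
    pastSum a p k ≤ pastSum a q k :=
  Finset.sum_le_sum_of_subset_of_nonneg (Finset.range_mono h)
    fun _ _ _ => pastLength_nonneg ha _ _

theorem pastSum_succ_succ (a : ℕ → ℝ) (p k : ℕ) :
    pastSum a (p + 1) (k + 1) = a k + pastSum a p k := by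
  rw [pastSum, Finset.sum_range_succ', add_comm]
  simp only [pastLength_succ_succ, pastLength_zero, pastSum]

theorem pastSum_add_add (a : ℕ → ℝ) (p k i : ℕ) :
    pastSum a (p + i) (k + i) = ∑ j ∈ Finset.range i, a (k + j) + pastSum a p k := by
  induction i with
  | zero => simp
  | succ i ih =>
    rw [← add_assoc, ← add_assoc, pastSum_succ_succ, ih, Finset.sum_range_succ]
    ring

theorem add_pastSum_nonneg (ha : ∀ k, 0 ≤ a k) (p k : ℕ) : 0 ≤ a k + pastSum a p k :=
  add_nonneg (ha k) (pastSum_nonneg ha p k)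

theorem pastSum_le_mul {A : ℝ} (hA : 1 ≤ A) {k : ℕ} (h : ∀ j < k, a j ≤ A) (p : ℕ) :
    pastSum a p k ≤ p * A := by
  have hle : ∀ i ∈ Finset.range p, pastLength a k (i + 1) ≤ A := fun i _ => by
    unfold pastLength
    split_ifs with hi
    · exact h _ (by omega)
    · exact hA
  simpa [pastSum] using Finset.sum_le_card_nsmul _ _ _ hle

theorem sum_pastLength_pow_le (ha : ∀ k, 0 ≤ a k) (r N i : ℕ) :
    ∑ k ∈ Finset.range N, pastLength a k i ^ r ≤ ∑ k ∈ Finset.range N, a k ^ r + i := by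
  induction i generalizing N with
  | zero => simp [pastLength_zero]
  | succ i ih =>
    cases N with
    | zero =>
      rw [Finset.sum_range_zero, Finset.sum_range_zero, zero_add]
      exact Nat.cast_nonneg _
    | succ N =>
      rw [Finset.sum_range_succ', Finset.sum_range_succ, pastLength_of_lt a i.succ_pos, one_pow]
      simp only [pastLength_succ_succ]
      push_cast
      linarith [ih N, pow_nonneg (ha N) r]

theorem sum_add_pastSum_pow_le (ha : ∀ k, 0 ≤ a k) (r p N : ℕ) :
    ∑ k ∈ Finset.range N, (a k + pastSum a p k) ^ (r + 1) ≤
      (p + 1 : ℝ) ^ (r + 1) * (∑ k ∈ Finset.range N, a k ^ (r + 1) + p) := by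
  have power_mean : ∀ k, (a k + pastSum a p k) ^ (r + 1) ≤
      (p + 1 : ℝ) ^ r * ∑ i ∈ Finset.range (p + 1), pastLength a k i ^ (r + 1) := fun k => by
    rw [← pastLength_zero a k, add_comm, pastSum, ← Finset.sum_range_succ']
    simpa using pow_sum_le_card_mul_sum_pow (s := Finset.range (p + 1))
      (f := pastLength a k) (fun i _ => pastLength_nonneg ha k i) r
  calc ∑ k ∈ Finset.range N, (a k + pastSum a p k) ^ (r + 1)
      ≤ ∑ k ∈ Finset.range N,
          (p + 1 : ℝ) ^ r * ∑ i ∈ Finset.range (p + 1), pastLength a k i ^ (r + 1) :=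
        Finset.sum_le_sum fun k _ => power_mean k
    _ = (p + 1 : ℝ) ^ r *
          ∑ i ∈ Finset.range (p + 1), ∑ k ∈ Finset.range N, pastLength a k i ^ (r + 1) := by
        rw [← Finset.mul_sum, Finset.sum_comm]
    _ ≤ (p + 1 : ℝ) ^ r *
          ∑ _i ∈ Finset.range (p + 1), (∑ k ∈ Finset.range N, a k ^ (r + 1) + p) := by
        gcongr with i hi
        refine (sum_pastLength_pow_le ha (r + 1) N i).trans ?_
        gcongr
        exact Finset.mem_range_succ_iff.1 hi
    _ = (p + 1 : ℝ) ^ (r + 1) * (∑ k ∈ Finset.range N, a k ^ (r + 1) + p) := by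
        rw [Finset.sum_const, Finset.card_range, nsmul_eq_mul]
        push_cast
        ring

end PastSteps

/-- The constants of the scalar recursion: the number `p` of past steps that enter the error
`D * ∑ ‖s_{k-i}‖` of the tensor of an iteration, the initial regularization parameter `σ₀`, the
tolerance `θ` of the tests on the step, and bounds `κ` on the third derivative, `Δ` on the
possible decrease of the objective, and `G` and `B` on the gradient norm and the negative
curvature at the starting point. -/
structure RecursionConstants where
  p : ℕ
  σ₀ : ℝ
  θ : ℝ≥0
  D : ℝ≥0
  κ : ℝ≥0
  Δ : ℝ≥0
  G : ℝ≥0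
  B : ℝ≥0
  σ₀_pos : 0 < σ₀

/-- The scalar inequalities satisfied in iterations `0, …, N` by the step lengths `a`, the
regularization parameters `σ`, the function values `F`, the gradient norms `g` and the negative
curvatures `c` of a run. -/
structure IsStepSequence (P : RecursionConstants) (a σ F g c : ℕ → ℝ) (N : ℕ) : Prop where
  nonneg : ∀ k, 0 ≤ a k
  σ_zero : σ 0 = P.σ₀
  σ_succ : ∀ k, σ (k + 1) = σ k + σ k * a k ^ 4
  gap : ∀ k, F 0 - F k ≤ P.Δ
  grad_zero : g 0 ≤ P.G
  curv_zero : c 0 ≤ P.B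
  descent : ∀ k ≤ N, F (k + 1) - F k + σ k / 24 * a k ^ 4 ≤ P.D * (a k + pastSum a P.p k) ^ 4
  step : ∀ k ≤ N, σ k / 24 * a k ^ 4 ≤
    g k * a k + c k * a k ^ 2 + (P.κ + P.D * pastSum a P.p k) * a k ^ 3
  grad : ∀ k ≤ N, g (k + 1) ≤ (P.θ * σ k + P.D) * (a k + pastSum a P.p k) ^ 3
  curv : ∀ k ≤ N, c (k + 1) ≤ (P.θ * σ k + P.D) * (a k + pastSum a P.p k) ^ 2

theorem le_max_of_quartic_le {r x y z s : ℝ} (hx : 0 ≤ x) (hy : 0 ≤ y) (hs : 0 < s)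
    (h : s * r ^ 4 ≤ x * r + y * r ^ 2 + z * r ^ 3) : r ≤ max 1 ((x + y + z) / s) := by
  rcases le_or_gt r 1 with hr | hr
  · exact hr.trans (le_max_left _ _)
  · refine le_max_of_le_right ((le_div_iff₀ hs).2 (le_of_mul_le_mul_left ?_ (pow_pos
      (one_pos.trans hr) 3)))
    calc r ^ 3 * (r * s) = s * r ^ 4 := by ring
      _ ≤ x * r + y * r ^ 2 + z * r ^ 3 := h
      _ ≤ x * r ^ 3 + y * r ^ 3 + z * r ^ 3 := by
          gcongr
          · exact le_self_pow₀ hr.le (by norm_num)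
          · exact hr.le
          · norm_num
      _ = r ^ 3 * (x + y + z) := by ring

namespace RecursionConstants

variable (P : RecursionConstants)

/-- A bound on the steps made before the regularization parameter exceeds `S`, the last one
excepted. -/
noncomputable def earlyStepBound (S : ℝ) : ℝ := 1 + S / P.σ₀

/-- A bound on all steps made while the regularization parameter is at most `S`. -/
noncomputable def stepBound (S : ℝ) : ℝ :=
  let μ := (P.p + 1) * P.earlyStepBound S
  max 1 (((P.G + (P.θ * S + P.D) * μ ^ 3) + (P.B + (P.θ * S + P.D) * μ ^ 2) +
    (P.κ + P.D * (P.p * P.earlyStepBound S))) / (P.σ₀ / 24))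

/-- The constant in front of `∑ ‖s_k‖ ^ 4` in the telescoped descent inequalities. -/
noncomputable def errorConstant : ℝ := P.D * (P.p + 1) ^ 4

/-- The value above which the regularization term dominates the error of the model. -/
noncomputable def σThreshold : ℝ := P.σ₀ + 48 * P.errorConstant

/-- A bound on the regularization parameter right after an iteration where it is at most
`P.σThreshold`. -/
noncomputable def σOvershoot : ℝ := P.σThreshold * (1 + P.stepBound P.σThreshold ^ 4)

/-- A bound on all regularization parameters. -/
noncomputable def σBound : ℝ :=
  2 * P.σ₀ + 48 * (P.Δ + P.errorConstant * (P.σOvershoot / P.σ₀ + P.p))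

/-- A bound on the factors `θ * σ k + D` in front of the gradient and curvature bounds. -/
noncomputable def stationarityConstant : ℝ := 1 + P.θ * P.σBound + P.D

/-- The constant of the iteration complexity bound. -/
noncomputable def complexityConstant : ℝ :=
  1 + P.stationarityConstant ^ 2 * ((P.p + 1) ^ 4 * (P.σBound / P.σ₀ + P.p))

theorem errorConstant_nonneg : 0 ≤ P.errorConstant := by
  unfold errorConstant
  positivity

theorem σ₀_le_σThreshold : P.σ₀ ≤ P.σThreshold :=
  le_add_of_nonneg_right (mul_nonneg (by norm_num) P.errorConstant_nonneg)

theorem σThreshold_pos : 0 < P.σThreshold := P.σ₀_pos.trans_le P.σ₀_le_σThreshold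

theorem σOvershoot_nonneg : 0 ≤ P.σOvershoot := by
  have := P.σThreshold_pos
  unfold σOvershoot
  positivity

theorem σBound_nonneg : 0 ≤ P.σBound := by
  have := P.σ₀_pos
  have := P.errorConstant_nonneg
  have := P.σOvershoot_nonneg
  unfold σBound
  positivity

theorem one_le_stationarityConstant : 1 ≤ P.stationarityConstant := by
  have := P.σBound_nonneg
  rw [stationarityConstant, add_assoc]
  exact le_add_of_nonneg_right (by positivity)

theorem complexityConstant_pos : 0 < P.complexityConstant := by
  have := P.σ₀_pos
  have := P.σBound_nonneg
  unfold complexityConstant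
  positivity

end RecursionConstants

namespace IsStepSequence

variable {P : RecursionConstants} {a σ F g c : ℕ → ℝ} {N : ℕ}

theorem le_σ (h : IsStepSequence P a σ F g c N) (k : ℕ) : P.σ₀ ≤ σ k := by
  induction k with
  | zero => exact h.σ_zero.ge
  | succ k ih =>
    rw [h.σ_succ]
    exact ih.trans (le_add_of_nonneg_right
      (mul_nonneg (P.σ₀_pos.le.trans ih) (pow_nonneg (h.nonneg k) 4)))

theorem σ_pos (h : IsStepSequence P a σ F g c N) (k : ℕ) : 0 < σ k :=
  P.σ₀_pos.trans_le (h.le_σ k)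

theorem monotone_σ (h : IsStepSequence P a σ F g c N) : Monotone σ :=
  monotone_nat_of_le_succ fun k => (h.σ_succ k).symm ▸
    le_add_of_nonneg_right (mul_nonneg (h.σ_pos k).le (pow_nonneg (h.nonneg k) 4))

theorem σ_eq_add_sum (h : IsStepSequence P a σ F g c N) (k : ℕ) :
    σ k = P.σ₀ + ∑ j ∈ Finset.range k, σ j * a j ^ 4 := by
  induction k with
  | zero => simp [h.σ_zero]
  | succ k ih => rw [h.σ_succ, Finset.sum_range_succ, ← add_assoc, ← ih]

theorem sum_pow_le_div (h : IsStepSequence P a σ F g c N) (k : ℕ) :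
    ∑ j ∈ Finset.range k, a j ^ 4 ≤ σ k / P.σ₀ := by
  rw [le_div_iff₀' P.σ₀_pos, Finset.mul_sum, h.σ_eq_add_sum k]
  refine (Finset.sum_le_sum fun j _ => ?_).trans (le_add_of_nonneg_left P.σ₀_pos.le)
  exact mul_le_mul_of_nonneg_right (h.le_σ j) (pow_nonneg (h.nonneg j) 4)

theorem le_earlyStepBound (h : IsStepSequence P a σ F g c N) {S : ℝ} {j : ℕ}
    (hS : σ (j + 1) ≤ S) : a j ≤ P.earlyStepBound S := by
  have hpow : a j ^ 4 ≤ S / P.σ₀ :=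
    calc a j ^ 4 ≤ ∑ i ∈ Finset.range (j + 1), a i ^ 4 :=
          Finset.single_le_sum (f := fun i => a i ^ 4) (fun i _ => pow_nonneg (h.nonneg i) 4)
            (Finset.self_mem_range_succ j)
      _ ≤ σ (j + 1) / P.σ₀ := h.sum_pow_le_div (j + 1)
      _ ≤ S / P.σ₀ := div_le_div_of_nonneg_right hS P.σ₀_pos.le
  unfold RecursionConstants.earlyStepBound
  rcases le_or_gt (a j) 1 with ha | ha
  · linarith [pow_nonneg (h.nonneg j) 4]
  · linarith [le_self_pow₀ ha.le (n := 4) (by norm_num)]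

theorem one_le_earlyStepBound (h : IsStepSequence P a σ F g c N) {S : ℝ} {k : ℕ}
    (hS : σ k ≤ S) : 1 ≤ P.earlyStepBound S :=
  le_add_of_nonneg_right (div_nonneg ((h.σ_pos k).le.trans hS) P.σ₀_pos.le)

theorem pastSum_le (h : IsStepSequence P a σ F g c N) {S : ℝ} {k : ℕ} (hS : σ k ≤ S) (p : ℕ) :
    pastSum a p k ≤ p * P.earlyStepBound S :=
  pastSum_le_mul (h.one_le_earlyStepBound hS)
    (fun _ hj => h.le_earlyStepBound ((h.monotone_σ hj).trans hS)) p

theorem grad_curv_le (h : IsStepSequence P a σ F g c N) {S : ℝ} {k : ℕ} (hk : k ≤ N)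
    (hS : σ k ≤ S) :
    g k ≤ P.G + (P.θ * S + P.D) * ((P.p + 1) * P.earlyStepBound S) ^ 3 ∧
      c k ≤ P.B + (P.θ * S + P.D) * ((P.p + 1) * P.earlyStepBound S) ^ 2 := by
  have hS0 : 0 ≤ S := (h.σ_pos k).le.trans hS
  have hA0 : 0 ≤ P.earlyStepBound S := zero_le_one.trans (h.one_le_earlyStepBound hS)
  rcases k with _ | j
  · exact ⟨h.grad_zero.trans (le_add_of_nonneg_right (by positivity)),
      h.curv_zero.trans (le_add_of_nonneg_right (by positivity))⟩
  · have hσj : σ j ≤ S := (h.monotone_σ j.le_succ).trans hS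
    have hμ : a j + pastSum a P.p j ≤ (P.p + 1) * P.earlyStepBound S := by
      linarith [h.le_earlyStepBound hS, h.pastSum_le hσj P.p]
    have hμ0 := add_pastSum_nonneg h.nonneg P.p j
    constructor
    · refine (h.grad j (by omega)).trans (le_add_of_nonneg_of_le P.G.coe_nonneg ?_)
      gcongr
    · refine (h.curv j (by omega)).trans (le_add_of_nonneg_of_le P.B.coe_nonneg ?_)
      gcongr

theorem le_stepBound (h : IsStepSequence P a σ F g c N) {S : ℝ} {k : ℕ} (hk : k ≤ N)
    (hS : σ k ≤ S) : a k ≤ P.stepBound S := by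
  have hS0 : 0 ≤ S := (h.σ_pos k).le.trans hS
  have hA0 : 0 ≤ P.earlyStepBound S := zero_le_one.trans (h.one_le_earlyStepBound hS)
  have hσ₀ := P.σ₀_pos
  have ha := h.nonneg k
  obtain ⟨hg, hc⟩ := h.grad_curv_le hk hS
  refine le_max_of_quartic_le (by positivity) (by positivity) (by positivity) ?_
  calc P.σ₀ / 24 * a k ^ 4 ≤ σ k / 24 * a k ^ 4 := by
        gcongr
        exact h.le_σ k
    _ ≤ g k * a k + c k * a k ^ 2 + (P.κ + P.D * pastSum a P.p k) * a k ^ 3 := h.step k hk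
    _ ≤ _ := by
        gcongr
        exact h.pastSum_le hS P.p

theorem σ_succ_le_σOvershoot (h : IsStepSequence P a σ F g c N) {k : ℕ} (hk : k ≤ N)
    (hσ : σ k ≤ P.σThreshold) : σ (k + 1) ≤ P.σOvershoot := by
  have ha := h.nonneg k
  rw [h.σ_succ, RecursionConstants.σOvershoot, ← mul_one_add]
  gcongr
  · exact P.σThreshold_pos.le
  · exact h.le_stepBound hk hσ

/-- The steps made before the last iteration with `σ ≤ P.σThreshold` contribute at most the
first term, because `σ` itself accumulates their fourth powers. -/
theorem sum_pow_le_add (h : IsStepSequence P a σ F g c N) {K : ℕ} (hK : K ≤ N + 1) :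
    ∑ k ∈ Finset.range K, a k ^ 4 ≤ P.σOvershoot / P.σ₀ + σ K / P.σThreshold := by
  have hS := P.σThreshold_pos
  induction K with
  | zero =>
    rw [Finset.sum_range_zero]
    exact add_nonneg (div_nonneg P.σOvershoot_nonneg P.σ₀_pos.le)
      (div_nonneg (h.σ_pos 0).le hS.le)
  | succ K ih =>
    rcases le_or_gt (σ K) P.σThreshold with hσ | hσ
    · refine (h.sum_pow_le_div (K + 1)).trans (le_add_of_le_of_nonneg ?_
        (div_nonneg (h.σ_pos _).le hS.le))
      exact div_le_div_of_nonneg_right (h.σ_succ_le_σOvershoot (by omega) hσ) P.σ₀_pos.le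
    · have hlast : a K ^ 4 ≤ σ K * a K ^ 4 / P.σThreshold := by
        rw [le_div_iff₀' hS]
        exact mul_le_mul_of_nonneg_right hσ.le (pow_nonneg (h.nonneg K) 4)
      rw [Finset.sum_range_succ, h.σ_succ, add_div]
      linarith [ih (by omega)]

theorem sum_σ_mul_pow_le (h : IsStepSequence P a σ F g c N) {K : ℕ} (hK : K ≤ N + 1) :
    ∑ k ∈ Finset.range K, σ k * a k ^ 4 ≤
      24 * (P.Δ + P.errorConstant * (∑ k ∈ Finset.range K, a k ^ 4 + P.p)) := by
  have telescoped : ∑ k ∈ Finset.range K, (F (k + 1) - F k + σ k / 24 * a k ^ 4) ≤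
      ∑ k ∈ Finset.range K, P.D * (a k + pastSum a P.p k) ^ 4 :=
    Finset.sum_le_sum fun k hk => h.descent k (by have := Finset.mem_range.1 hk; omega)
  have hpow := mul_le_mul_of_nonneg_left (sum_add_pastSum_pow_le h.nonneg 3 P.p K)
    P.D.coe_nonneg
  rw [Finset.sum_add_distrib, Finset.sum_range_sub, ← Finset.mul_sum] at telescoped
  simp only [div_mul_eq_mul_div, ← Finset.sum_div] at telescoped
  simp only [← mul_assoc, Nat.reduceAdd] at hpow
  unfold RecursionConstants.errorConstant
  linarith [h.gap K]

theorem σ_le_σBound (h : IsStepSequence P a σ F g c N) {K : ℕ} (hK : K ≤ N + 1) :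
    σ K ≤ P.σBound := by
  have hQ := P.errorConstant_nonneg
  have half : 24 * P.errorConstant * (σ K / P.σThreshold) ≤ σ K / 2 := by
    rw [mul_div_left_comm, div_eq_mul_inv (σ K)]
    refine mul_le_mul_of_nonneg_left ?_ (h.σ_pos K).le
    rw [div_le_iff₀ P.σThreshold_pos, RecursionConstants.σThreshold]
    linarith [P.σ₀_pos]
  have hsum := mul_le_mul_of_nonneg_left (h.sum_pow_le_add hK) hQ
  have hσ := h.σ_eq_add_sum K
  unfold RecursionConstants.σBound
  linarith [h.sum_σ_mul_pow_le hK]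

end IsStepSequence

theorem one_le_pow_mul_rpow_neg_mul_pow {ε C μ q : ℝ} {i j t : ℕ} (hε : 0 < ε) (hC : 1 ≤ C)
    (hμ : 0 ≤ μ) (hq : 0 ≤ q) (hqt : q ≤ t) (hij : i * q = j) (h : ε ≤ C * μ ^ i) :
    1 ≤ C ^ t * ε ^ (-q) * μ ^ j := by
  have hC0 : 0 ≤ C := zero_le_one.trans hC
  calc 1 = ε ^ (-q) * ε ^ q := by rw [← Real.rpow_add hε, neg_add_cancel, Real.rpow_zero]
    _ ≤ ε ^ (-q) * (C * μ ^ i) ^ q := by gcongr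
    _ = ε ^ (-q) * (C ^ q * μ ^ j) := by
        rw [Real.mul_rpow hC0 (by positivity), ← Real.rpow_natCast_mul hμ, hij,
          Real.rpow_natCast]
    _ ≤ ε ^ (-q) * (C ^ t * μ ^ j) := by
        gcongr
        rw [← Real.rpow_natCast C t]
        exact Real.rpow_le_rpow_of_exponent_le hC hqt
    _ = C ^ t * ε ^ (-q) * μ ^ j := by ring

section Complexity

variable {P : RecursionConstants} {a σ F g c : ℕ → ℝ} {N : ℕ}

theorem IsStepSequence.one_le_of_not_stationary (h : IsStepSequence P a σ F g c N)
    {ε₁ ε₂ M : ℝ} (hε₁ : 0 < ε₁) (hε₂ : 0 < ε₂) (hM₁ : ε₁ ^ (-(4 / 3) : ℝ) ≤ M)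
    (hM₂ : ε₂ ^ (-2 : ℝ) ≤ M) {k : ℕ} (hk : k ≤ N) (hε : ε₁ < g (k + 1) ∨ ε₂ < c (k + 1)) :
    1 ≤ P.stationarityConstant ^ 2 * M * (a k + pastSum a P.p k) ^ 4 := by
  have hμ := add_pastSum_nonneg h.nonneg P.p k
  have hE := P.one_le_stationarityConstant
  have hσ : P.θ * σ k + P.D ≤ P.stationarityConstant := by
    have := mul_le_mul_of_nonneg_left (h.σ_le_σBound (hk.trans N.le_succ)) P.θ.coe_nonneg
    unfold RecursionConstants.stationarityConstant
    linarith
  rcases hε with hg | hc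
  · have hle := (hg.le.trans (h.grad k hk)).trans (mul_le_mul_of_nonneg_right hσ (by positivity))
    refine (one_le_pow_mul_rpow_neg_mul_pow (q := 4 / 3) (j := 4) (t := 2) hε₁ hE hμ
      (by norm_num) (by norm_num) (by norm_num) hle).trans ?_
    gcongr
  · have hle := (hc.le.trans (h.curv k hk)).trans (mul_le_mul_of_nonneg_right hσ (by positivity))
    refine (one_le_pow_mul_rpow_neg_mul_pow (q := 2) (j := 4) (t := 2) hε₂ hE hμ
      (by norm_num) (by norm_num) (by norm_num) hle).trans ?_
    gcongr

theorem IsStepSequence.succ_le_complexityConstant_mul (h : IsStepSequence P a σ F g c N)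
    {ε₁ ε₂ M : ℝ} (hε₁ : 0 < ε₁) (hε₂ : 0 < ε₂) (hM : 1 ≤ M)
    (hM₁ : ε₁ ^ (-(4 / 3) : ℝ) ≤ M) (hM₂ : ε₂ ^ (-2 : ℝ) ≤ M)
    (hε : ∀ k ≤ N, ε₁ < g k ∨ ε₂ < c k) : (N + 1 : ℝ) ≤ P.complexityConstant * M := by
  have hσ₀ := P.σ₀_pos
  have hN : (N : ℝ) ≤ P.stationarityConstant ^ 2 * M *
      ((P.p + 1) ^ 4 * (P.σBound / P.σ₀ + P.p)) :=
    calc (N : ℝ) = ∑ k ∈ Finset.range N, 1 := by simp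
      _ ≤ ∑ k ∈ Finset.range N,
            P.stationarityConstant ^ 2 * M * (a k + pastSum a P.p k) ^ 4 :=
          Finset.sum_le_sum fun k hk =>
            have hkN : k < N := Finset.mem_range.1 hk
            h.one_le_of_not_stationary hε₁ hε₂ hM₁ hM₂ hkN.le (hε (k + 1) hkN)
      _ = P.stationarityConstant ^ 2 * M *
            ∑ k ∈ Finset.range N, (a k + pastSum a P.p k) ^ 4 := by rw [Finset.mul_sum]
      _ ≤ P.stationarityConstant ^ 2 * M *
            ((P.p + 1) ^ 4 * (∑ k ∈ Finset.range N, a k ^ 4 + P.p)) := by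
          gcongr
          exact sum_add_pastSum_pow_le h.nonneg 3 P.p N
      _ ≤ P.stationarityConstant ^ 2 * M * ((P.p + 1) ^ 4 * (P.σBound / P.σ₀ + P.p)) := by
          gcongr
          exact (h.sum_pow_le_div N).trans
            (div_le_div_of_nonneg_right (h.σ_le_σBound N.le_succ) hσ₀.le)
  calc (N + 1 : ℝ) ≤ P.stationarityConstant ^ 2 * M *
        ((P.p + 1) ^ 4 * (P.σBound / P.σ₀ + P.p)) + M := add_le_add hN hM
    _ = P.complexityConstant * M := by
        unfold RecursionConstants.complexityConstant
        ring

end Complexity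

/-! ### Trial steps -/

theorem iteratedFDeriv_approxTaylor_zero {n k : ℕ} (hk : k < 3) {f : Vec n → ℝ}
    (hf : ContDiff ℝ k f) (x : Vec n) (T : Tensor 3 n) :
    iteratedFDeriv ℝ k (approxTaylor f x T) 0 = iteratedFDeriv ℝ k f x := by
  let A : FormalMultilinearSeries ℝ (Vec n) ℝ := Function.update (ftaylorSeries ℝ f x) 3 T
  have hA : A k = iteratedFDeriv ℝ k f x := Function.update_of_ne hk.ne ..
  have hsymm : ∀ (π : Equiv.Perm (Fin k)) v, A k (fun i => v (π i)) = A k v :=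
    hA ▸ iteratedFDeriv_comp_perm hf x
  rw [approxTaylor_eq_taylorPolynomial, ← hA]
  exact iteratedFDeriv_taylorPolynomial_zero hk.le hsymm

/-- The size of the most negative curvature of `f` at `x`: the negative part of the leftmost
eigenvalue of the Hessian. -/
noncomputable def negCurvature {n : ℕ} (f : Vec n → ℝ) (x : Vec n) : ℝ :=
  max 0 (-lambdaMin (hessMatrix f x))

theorem negCurvature_nonneg {n : ℕ} (f : Vec n → ℝ) (x : Vec n) : 0 ≤ negCurvature f x :=
  le_max_left _ _

theorem isApproxSecondOrder_iff {n : ℕ} {f : Vec n → ℝ} {ε₁ ε₂ : ℝ} (hε₂ : 0 ≤ ε₂) {x : Vec n} :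
    IsApproxSecondOrder f ε₁ ε₂ x ↔ ‖gradient f x‖ ≤ ε₁ ∧ negCurvature f x ≤ ε₂ := by
  rw [IsApproxSecondOrder, negCurvature, max_le_iff, neg_le, and_iff_right hε₂]

theorem negCurvature_le_add {n : ℕ} [NeZero n] {f g : Vec n → ℝ} (hf : ContDiff ℝ 2 f)
    (hg : ContDiff ℝ 2 g) (x y : Vec n) :
    negCurvature f x ≤ negCurvature g y + ‖iteratedFDeriv ℝ 2 f x - iteratedFDeriv ℝ 2 g y‖ := by
  refine max_le (add_nonneg (negCurvature_nonneg g y) (norm_nonneg _)) ?_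
  have hle : -lambdaMin (hessMatrix g y) ≤ negCurvature g y := le_max_right _ _
  linarith [lambdaMin_hessMatrix_le_add hf hg x y]

theorem neg_negCurvature_mul_sq_le {n : ℕ} [NeZero n] {f : Vec n → ℝ} (hf : ContDiff ℝ 2 f)
    (x v : Vec n) : -negCurvature f x * ‖v‖ ^ 2 ≤ iteratedFDeriv ℝ 2 f x fun _ => v :=
  (le_lambdaMin_hessMatrix_iff hf).1 (neg_le.1 (le_max_right _ _)) v

namespace IsTrialStep

variable {n : ℕ} {f : Vec n → ℝ} {θ₁ θ₂ σ : ℝ} {x s : Vec n} {T : Tensor 3 n}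

theorem approxTaylor_add_le (h : IsTrialStep f θ₁ θ₂ x T σ s) :
    approxTaylor f x T s + σ / 24 * ‖s‖ ^ 4 ≤ f x := by
  have hzero : ∀ {k : ℕ} [NeZero k] (A : Tensor k n), A (fun _ => 0) = 0 := fun A => A.map_zero
  have hx : approxTaylor f x T 0 = f x := by
    rw [approxTaylor, hzero, mul_zero, add_zero, add_eq_left]
    refine Finset.sum_eq_zero fun i hi => ?_
    have : NeZero i := ⟨by grind⟩
    rw [hzero, mul_zero]
  have hdec := h.decrease
  rw [model, model, hx, norm_zero, zero_pow four_ne_zero, mul_zero, add_zero] at hdec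
  exact sub_nonpos.1 hdec

theorem norm_gradient_le (h : IsTrialStep f θ₁ θ₂ x T σ s) :
    ‖gradient f (x + s)‖ ≤ θ₁ * σ * ‖s‖ ^ 3 / 6 +
      ‖iteratedFDeriv ℝ 1 f (x + s) - iteratedFDeriv ℝ 1 (approxTaylor f x T) s‖ := by
  have hfirst := h.first_order
  rw [norm_gradient_eq] at hfirst ⊢
  exact (norm_le_norm_add_norm_sub' _ _).trans (add_le_add_left hfirst _)

theorem negCurvature_le [NeZero n] (h : IsTrialStep f θ₁ θ₂ x T σ s) (hf : ContDiff ℝ 2 f) :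
    negCurvature f (x + s) ≤ θ₂ * σ * ‖s‖ ^ 2 / 2 +
      ‖iteratedFDeriv ℝ 2 f (x + s) - iteratedFDeriv ℝ 2 (approxTaylor f x T) s‖ :=
  (negCurvature_le_add hf (contDiff_approxTaylor f x T) (x + s) s).trans
    (add_le_add_left h.second_order _)

theorem isApproxSecondOrder_of_zero [NeZero n] (h : IsTrialStep f θ₁ θ₂ x T σ 0)
    (hf : ContDiff ℝ 2 f) {ε₁ ε₂ : ℝ} (hε₁ : 0 ≤ ε₁) (hε₂ : 0 ≤ ε₂) :
    IsApproxSecondOrder f ε₁ ε₂ x := by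
  have hgrad := h.norm_gradient_le
  have hcurv := h.negCurvature_le hf
  rw [add_zero, iteratedFDeriv_approxTaylor_zero (by norm_num) (hf.of_le (by norm_num)),
    sub_self, norm_zero, norm_zero, zero_pow (by norm_num), mul_zero, zero_div, add_zero]
    at hgrad
  rw [add_zero, iteratedFDeriv_approxTaylor_zero (by norm_num) hf,
    sub_self, norm_zero, norm_zero, zero_pow (by norm_num), mul_zero, zero_div, add_zero]
    at hcurv
  exact (isApproxSecondOrder_iff hε₂).2 ⟨hgrad.trans hε₁, hcurv.trans hε₂⟩

theorem mul_norm_pow_le [NeZero n] (h : IsTrialStep f θ₁ θ₂ x T σ s) (hf : ContDiff ℝ 2 f) :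
    σ / 24 * ‖s‖ ^ 4 ≤ ‖gradient f x‖ * ‖s‖ + negCurvature f x * ‖s‖ ^ 2 + ‖T‖ * ‖s‖ ^ 3 := by
  have hdec := h.approxTaylor_add_le
  have hgrad := (iteratedFDeriv ℝ 1 f x).le_opNorm fun _ => s
  have hcurv := neg_negCurvature_mul_sq_le hf x s
  have hT := T.le_opNorm fun _ => s
  rw [Finset.prod_const, Finset.card_fin, Real.norm_eq_abs, abs_le] at hgrad hT
  rw [← norm_gradient_eq, pow_one] at hgrad
  have hpair : Finset.Icc 1 2 = {1, 2} := rfl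
  rw [approxTaylor, hpair, Finset.sum_pair (by norm_num), Nat.factorial_one, Nat.factorial_two,
    show Nat.factorial 3 = 6 from rfl] at hdec
  push_cast at hdec
  have := mul_nonneg (negCurvature_nonneg f x) (sq_nonneg ‖s‖)
  linarith [hgrad.1, hT.1, (show 0 ≤ ‖T‖ * ‖s‖ ^ 3 by positivity)]

variable {L : ℝ≥0} {D ν θ : ℝ}

theorem descent (h : IsTrialStep f θ₁ θ₂ x T σ s) (hf : ContDiff ℝ 3 f)
    (hL : LipschitzWith L (iteratedFDeriv ℝ 3 f)) (hT : IsSymmTensor T) (hLD : L ≤ D)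
    (hν : 0 ≤ ν) (hTν : ‖T - iteratedFDeriv ℝ 3 f x‖ ≤ D * ν) :
    f (x + s) - f x + σ / 24 * ‖s‖ ^ 4 ≤ D * (‖s‖ + ν) ^ 4 := by
  have hrem := norm_iteratedFDeriv_sub_approxTaylor_le hf hL hT hLD hν hTν s 3 0 rfl
  have happly := (iteratedFDeriv ℝ 0 f (x + s)
    - iteratedFDeriv ℝ 0 (approxTaylor f x T) s).le_opNorm 0
  rw [sub_apply, iteratedFDeriv_zero_apply, iteratedFDeriv_zero_apply, Fin.prod_univ_zero,
    mul_one, Real.norm_eq_abs] at happly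
  norm_num only at hrem
  linarith [h.approxTaylor_add_le, (le_abs_self _).trans happly]

theorem norm_gradient_le_mul_pow (h : IsTrialStep f θ₁ θ₂ x T σ s) (hf : ContDiff ℝ 3 f)
    (hL : LipschitzWith L (iteratedFDeriv ℝ 3 f)) (hT : IsSymmTensor T) (hLD : L ≤ D)
    (hν : 0 ≤ ν) (hTν : ‖T - iteratedFDeriv ℝ 3 f x‖ ≤ D * ν) (hσ : 0 ≤ σ) (hθ : 0 ≤ θ)
    (hθ₁ : θ₁ ≤ θ) : ‖gradient f (x + s)‖ ≤ (θ * σ + D) * (‖s‖ + ν) ^ 3 := by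
  have htest : θ₁ * σ * ‖s‖ ^ 3 / 6 ≤ θ * σ * (‖s‖ + ν) ^ 3 :=
    calc θ₁ * σ * ‖s‖ ^ 3 / 6 ≤ θ * σ * (‖s‖ + ν) ^ 3 / 6 := by
          gcongr
          exact le_add_of_nonneg_right hν
      _ ≤ θ * σ * (‖s‖ + ν) ^ 3 := div_le_self (by positivity) (by norm_num)
  rw [add_mul]
  exact h.norm_gradient_le.trans (add_le_add htest
    (norm_iteratedFDeriv_sub_approxTaylor_le hf hL hT hLD hν hTν s 2 1 rfl))

theorem negCurvature_le_mul_pow [NeZero n] (h : IsTrialStep f θ₁ θ₂ x T σ s)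
    (hf : ContDiff ℝ 3 f) (hL : LipschitzWith L (iteratedFDeriv ℝ 3 f)) (hT : IsSymmTensor T)
    (hLD : L ≤ D) (hν : 0 ≤ ν) (hTν : ‖T - iteratedFDeriv ℝ 3 f x‖ ≤ D * ν) (hσ : 0 ≤ σ)
    (hθ : 0 ≤ θ) (hθ₂ : θ₂ ≤ θ) :
    negCurvature f (x + s) ≤ (θ * σ + D) * (‖s‖ + ν) ^ 2 := by
  have htest : θ₂ * σ * ‖s‖ ^ 2 / 2 ≤ θ * σ * (‖s‖ + ν) ^ 2 :=
    calc θ₂ * σ * ‖s‖ ^ 2 / 2 ≤ θ * σ * (‖s‖ + ν) ^ 2 / 2 := by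
          gcongr
          exact le_add_of_nonneg_right hν
      _ ≤ θ * σ * (‖s‖ + ν) ^ 2 := div_le_self (by positivity) (by norm_num)
  rw [add_mul]
  exact (h.negCurvature_le (hf.of_le (by norm_num))).trans (add_le_add htest
    (norm_iteratedFDeriv_sub_approxTaylor_le hf hL hT hLD hν hTν s 1 2 rfl))

end IsTrialStep

/-! ### Runs of the algorithm -/

section Runs

variable {n m : ℕ} {f : Vec n → ℝ} {L : ℝ≥0} {θ₁ θ₂ σ₀ : ℝ} {x₀ : Vec n} {R : Iterates n}

theorem IsRun.σ_nonneg (hR : IsRun f θ₁ θ₂ σ₀ x₀ R) (hσ₀ : 0 ≤ σ₀) (k : ℕ) : 0 ≤ R.σ k := by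
  induction k with
  | zero => exact hR.σ_zero ▸ hσ₀
  | succ k ih =>
    rw [hR.σ_succ]
    positivity

theorem IsRun.isStepSequence [NeZero n] (hf : ContDiff ℝ 3 f)
    (hL : LipschitzWith L (iteratedFDeriv ℝ 3 f)) {P : RecursionConstants}
    (hκ : ∀ x, ‖iteratedFDeriv ℝ 3 f x‖ ≤ P.κ) {flow : ℝ} (hflow : ∀ x, flow ≤ f x)
    (hx₀ : StartBounds f flow x₀ P.Δ P.G P.B) (hLD : L ≤ P.D) (hθ₁ : θ₁ ≤ P.θ)
    (hθ₂ : θ₂ ≤ P.θ) (hR : IsRun f θ₁ θ₂ P.σ₀ x₀ R) (hsymm : ∀ k, IsSymmTensor (R.T k)) {N : ℕ}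
    (herr : ∀ k ≤ N, ‖R.T k - iteratedFDeriv ℝ 3 f (R.x k)‖ ≤
      P.D * pastSum (fun j => ‖R.s j‖) P.p k) :
    IsStepSequence P (fun k => ‖R.s k‖) R.σ (fun k => f (R.x k))
      (fun k => ‖gradient f (R.x k)‖) (fun k => negCurvature f (R.x k)) N := by
  have hσ := hR.σ_nonneg P.σ₀_pos.le
  have hν := pastSum_nonneg (fun k => norm_nonneg (R.s k)) P.p
  have hLD' : (L : ℝ) ≤ P.D := NNReal.coe_le_coe.2 hLD
  exact
  { nonneg := fun k => norm_nonneg _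
    σ_zero := hR.σ_zero
    σ_succ := hR.σ_succ
    gap := fun k => (sub_le_sub_left (hflow _) _).trans (hR.x_zero ▸ hx₀.gap)
    grad_zero := hR.x_zero ▸ hx₀.grad
    curv_zero := hR.x_zero ▸ hx₀.curv
    descent := fun k hk => hR.x_succ k ▸
      (hR.step k).descent hf hL (hsymm k) hLD' (hν k) (herr k hk)
    step := fun k hk => by
      refine ((hR.step k).mul_norm_pow_le (hf.of_le (by norm_num))).trans ?_
      gcongr
      exact (norm_le_norm_add_norm_sub' _ _).trans (add_le_add (hκ _) (herr k hk))
    grad := fun k hk => hR.x_succ k ▸ (hR.step k).norm_gradient_le_mul_pow hf hL (hsymm k) hLD'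
      (hν k) (herr k hk) (hσ k) P.θ.coe_nonneg hθ₁
    curv := fun k hk => hR.x_succ k ▸ (hR.step k).negCurvature_le_mul_pow hf hL (hsymm k) hLD'
      (hν k) (herr k hk) (hσ k) P.θ.coe_nonneg hθ₂ }

theorem PSBBetweenRestarts.norm_sub_iteratedFDeriv_le (hR : PSBBetweenRestarts f m R)
    (hf : ContDiff ℝ 3 f) (hL : LipschitzWith L (iteratedFDeriv ℝ 3 f))
    (hx : ∀ k, R.x (k + 1) = R.x k + R.s k) (hsymm : ∀ k, IsSymmTensor (R.T k)) {k i : ℕ}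
    (hi : ∀ j < i, (k + j + 1) % m ≠ 0) :
    ‖R.T (k + i) - iteratedFDeriv ℝ 3 f (R.x (k + i))‖ ≤
      ‖R.T k - iteratedFDeriv ℝ 3 f (R.x k)‖ +
        2 * L * ∑ j ∈ Finset.range i, ‖R.s (k + j)‖ := by
  induction i with
  | zero => simp
  | succ i ih =>
    have hT := hR (k + i + 1) (hi i i.lt_succ_self)
    rw [Nat.add_sub_cancel, hx] at hT
    have hupdate := hT.norm_sub_iteratedFDeriv_le hf hL (hsymm (k + i))
    rw [← hx, add_assoc] at hupdate
    rw [Finset.sum_range_succ, mul_add]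
    linarith [ih fun j hj => hi j (hj.trans i.lt_succ_self)]

/-- A run whose tensors are updated by the PSB formula between restarts and, as long as no step
has vanished, have an error of at most `L` times the length of the last `m` steps at each
restart. Both variants of the algorithm produce such runs. -/
structure IsPSBRun (f : Vec n → ℝ) (L : ℝ≥0) (m : ℕ) (θ₁ θ₂ σ₀ : ℝ) (x₀ : Vec n)
    (R : Iterates n) : Prop where
  run : IsRun f θ₁ θ₂ σ₀ x₀ R
  psb : PSBBetweenRestarts f m R
  isSymmTensor_restart : ∀ k, k % m = 0 → IsSymmTensor (R.T k)
  restart_error : ∀ k, k % m = 0 → (∀ j < k, R.s j ≠ 0) →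
    ‖R.T k - iteratedFDeriv ℝ 3 f (R.x k)‖ ≤ L * pastSum (fun j => ‖R.s j‖) m k

theorem IsLazyRestartRun.isPSBRun (hR : IsLazyRestartRun f m θ₁ θ₂ σ₀ x₀ R)
    (hf : ContDiff ℝ 3 f) (L : ℝ≥0) : IsPSBRun f L m θ₁ θ₂ σ₀ x₀ R where
  run := hR.run
  psb := hR.psb
  isSymmTensor_restart k hk := hR.restart k hk ▸ iteratedFDeriv_comp_perm hf (R.x k)
  restart_error k hk _ := by
    rw [hR.restart k hk, sub_self, norm_zero]
    exact mul_nonneg L.coe_nonneg (pastSum_nonneg (fun _ => norm_nonneg _) m k)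

theorem fdStep_eq (m : ℕ) (R : Iterates n) (k : ℕ) :
    fdStep m R k = min (pastSum (fun j => ‖R.s j‖) m k) 1 / √n := by
  rw [fdStep, pastSum, Finset.range_eq_Ico,
    Finset.sum_Ico_add' (fun i => pastLength (fun j => ‖R.s j‖) k i) 0 m 1]
  rfl

theorem IsFDRestartRun.isPSBRun [NeZero n] (hR : IsFDRestartRun f m θ₁ θ₂ σ₀ x₀ R) (hm : 1 ≤ m)
    (hf : ContDiff ℝ 3 f) (hL : LipschitzWith L (iteratedFDeriv ℝ 3 f)) :
    IsPSBRun f L m θ₁ θ₂ σ₀ x₀ R where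
  run := hR.run
  psb := hR.psb
  isSymmTensor_restart k hk := hR.restart k hk ▸ isSymmTensor_symProj _
  restart_error k hk hs := by
    have hn : 0 < √(n : ℝ) := Real.sqrt_pos.2 (Nat.cast_pos.2 (NeZero.pos n))
    have hpast : 0 < pastSum (fun j => ‖R.s j‖) m k :=
      pastSum_pos (fun _ => norm_nonneg _) hm fun j hj => norm_pos_iff.2 (hs j hj)
    have hh : 0 < fdStep m R k := fdStep_eq m R k ▸ div_pos (lt_min hpast one_pos) hn
    rw [hR.restart k hk]
    refine (norm_symProj_fdTensor_sub_le hf hL _ hh).trans ?_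
    rw [mul_left_comm, fdStep_eq, mul_div_cancel₀ _ hn.ne']
    gcongr
    exact min_le_left _ _

namespace IsPSBRun

theorem isSymmTensor (hR : IsPSBRun f L m θ₁ θ₂ σ₀ x₀ R) (k : ℕ) : IsSymmTensor (R.T k) := by
  by_cases hk : k % m = 0
  · exact hR.isSymmTensor_restart k hk
  · exact (hR.psb k hk).1.1

theorem norm_sub_iteratedFDeriv_le (hR : IsPSBRun f L m θ₁ θ₂ σ₀ x₀ R) (hm : 1 ≤ m)
    (hf : ContDiff ℝ 3 f) (hL : LipschitzWith L (iteratedFDeriv ℝ 3 f)) {k : ℕ}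
    (hs : ∀ j < k, R.s j ≠ 0) :
    ‖R.T k - iteratedFDeriv ℝ 3 f (R.x k)‖ ≤
      (2 * L : ℝ≥0) * pastSum (fun j => ‖R.s j‖) (2 * m) k := by
  have hnonneg : ∀ j, 0 ≤ ‖R.s j‖ := fun _ => norm_nonneg _
  have hmod : k % m < m := Nat.mod_lt k hm
  set r := m * (k / m)
  have hrk : r + k % m = k := Nat.div_add_mod k m
  have hrestart := hR.restart_error r (Nat.mul_mod_right m _) fun j hj => hs j (by omega)
  have hupdates := hR.psb.norm_sub_iteratedFDeriv_le hf hL hR.run.x_succ hR.isSymmTensor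
    (k := r) (i := k % m) fun j hj => by
      rw [add_assoc, Nat.mul_add_mod, Nat.mod_eq_of_lt (by omega)]
      exact j.succ_ne_zero
  have hsplit := pastSum_add_add (fun j => ‖R.s j‖) m r (k % m)
  rw [hrk] at hupdates hsplit
  calc ‖R.T k - iteratedFDeriv ℝ 3 f (R.x k)‖
      ≤ L * pastSum (fun j => ‖R.s j‖) m r
          + 2 * L * ∑ j ∈ Finset.range (k % m), ‖R.s (r + j)‖ := by linarith
    _ ≤ 2 * L * pastSum (fun j => ‖R.s j‖) m r
          + 2 * L * ∑ j ∈ Finset.range (k % m), ‖R.s (r + j)‖ := by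
        gcongr
        · exact pastSum_nonneg hnonneg m r
        · exact le_mul_of_one_le_left L.coe_nonneg one_le_two
    _ = 2 * L * pastSum (fun j => ‖R.s j‖) (m + k % m) k := by
        rw [hsplit]
        ring
    _ ≤ (2 * L : ℝ≥0) * pastSum (fun j => ‖R.s j‖) (2 * m) k := by
        push_cast
        gcongr
        exact pastSum_mono hnonneg (by omega) k

end IsPSBRun

end Runs

/-! ### Evaluation complexity -/

/-- The constants of the scalar recursion satisfied by the runs of the algorithm: the tensor
error involves the steps since the last restart and those that the restart depends on, hence
`2 * m` past steps. -/
noncomputable def runConstants (m : ℕ) {σ₀ : ℝ} (hσ₀ : 0 < σ₀) (θ₁ θ₂ : ℝ) (L : ℝ≥0)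
    (κ Δ G B : ℝ) : RecursionConstants where
  p := 2 * m
  σ₀ := σ₀
  θ := max θ₁.toNNReal θ₂.toNNReal
  D := 2 * L
  κ := κ.toNNReal
  Δ := Δ.toNNReal
  G := G.toNNReal
  B := B.toNNReal
  σ₀_pos := hσ₀

theorem one_le_max_rpow_of_min_le_one {ε₁ ε₂ a b : ℝ} (hε₁ : 0 < ε₁) (hε₂ : 0 < ε₂)
    (hε : min ε₁ ε₂ ≤ 1) (ha : a ≤ 0) (hb : b ≤ 0) : 1 ≤ max (ε₁ ^ a) (ε₂ ^ b) :=
  (min_le_iff.1 hε).elim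
    (fun h => le_max_of_le_left (Real.one_le_rpow_of_pos_of_le_one_of_nonpos hε₁ h ha))
    (fun h => le_max_of_le_right (Real.one_le_rpow_of_pos_of_le_one_of_nonpos hε₂ h hb))

theorem ObjectiveAssumptions.lipschitzWith {n : ℕ} {f : Vec n → ℝ} {flow L κ : ℝ}
    (h : ObjectiveAssumptions f flow L κ) :
    LipschitzWith L.toNNReal (iteratedFDeriv ℝ 3 f) :=
  LipschitzWith.of_dist_le' fun x y => by
    simpa only [dist_eq_norm] using h.lipschitz x y

theorem StartBounds.mono {n : ℕ} {f : Vec n → ℝ} {flow : ℝ} {x₀ : Vec n} {Δ G B Δ' G' B' : ℝ}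
    (h : StartBounds f flow x₀ Δ G B) (hΔ : Δ ≤ Δ') (hG : G ≤ G') (hB : B ≤ B') :
    StartBounds f flow x₀ Δ' G' B' :=
  ⟨h.gap.trans hΔ, h.grad.trans hG, h.curv.trans hB⟩

section Complexity

variable {n m : ℕ} {f : Vec n → ℝ} {L : ℝ≥0} {θ₁ θ₂ σ₀ κ Δ G B flow ε₁ ε₂ : ℝ} {x₀ : Vec n}
  {R : Iterates n}

theorem IsPSBRun.exists_isApproxSecondOrder [NeZero n] (hR : IsPSBRun f L m θ₁ θ₂ σ₀ x₀ R)
    (hm : 1 ≤ m) (hσ₀ : 0 < σ₀) (hf : ContDiff ℝ 3 f)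
    (hL : LipschitzWith L (iteratedFDeriv ℝ 3 f)) (hκ : ∀ x, ‖iteratedFDeriv ℝ 3 f x‖ ≤ κ)
    (hflow : ∀ x, flow ≤ f x) (hx₀ : StartBounds f flow x₀ Δ G B) (hε₁ : 0 < ε₁)
    (hε₂ : 0 < ε₂) (hε : min ε₁ ε₂ ≤ 1) :
    ∃ K : ℕ, IsApproxSecondOrder f ε₁ ε₂ (R.x K) ∧
      K ≤ (runConstants m hσ₀ θ₁ θ₂ L κ Δ G B).complexityConstant *
        max (ε₁ ^ (-(4 / 3) : ℝ)) (ε₂ ^ (-2 : ℝ)) := by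
  set P := runConstants m hσ₀ θ₁ θ₂ L κ Δ G B
  set M := max (ε₁ ^ (-(4 / 3) : ℝ)) (ε₂ ^ (-2 : ℝ))
  have hM : 1 ≤ M := one_le_max_rpow_of_min_le_one hε₁ hε₂ hε (by norm_num) (by norm_num)
  have hC := P.complexityConstant_pos
  set N := ⌊P.complexityConstant * M⌋₊
  suffices ∃ K ≤ N, IsApproxSecondOrder f ε₁ ε₂ (R.x K) from
    let ⟨K, hKN, hK⟩ := this
    ⟨K, hK, (Nat.le_floor_iff (by positivity)).1 hKN⟩
  by_contra! hnot
  have hs : ∀ k ≤ N, R.s k ≠ 0 := fun k hk hsk =>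
    hnot k hk ((hsk ▸ hR.run.step k).isApproxSecondOrder_of_zero (hf.of_le (by norm_num))
      hε₁.le hε₂.le)
  have hseq := IsRun.isStepSequence (P := P) hf hL
    (fun x => (hκ x).trans (Real.le_coe_toNNReal κ)) hflow
    (hx₀.mono (Real.le_coe_toNNReal Δ) (Real.le_coe_toNNReal G) (Real.le_coe_toNNReal B))
    (le_mul_of_one_le_left' one_le_two)
    (Real.toNNReal_le_iff_le_coe.1 (le_max_left _ _))
    (Real.toNNReal_le_iff_le_coe.1 (le_max_right _ _)) hR.run hR.isSymmTensor
    fun k hk => hR.norm_sub_iteratedFDeriv_le hm hf hL fun j hj => hs j (hj.le.trans hk)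
  refine (Nat.lt_floor_add_one (P.complexityConstant * M)).not_ge
    (hseq.succ_le_complexityConstant_mul hε₁ hε₂ hM (le_max_left _ _) (le_max_right _ _)
      fun k hk => ?_)
  by_contra! hk'
  exact hnot k hk ((isApproxSecondOrder_iff hε₂.le).2 hk')

theorem evalCount_le {queries : ℕ → List (Query n)} {q : ℕ}
    (hq : ∀ k, (queries k).length ≤ q) (K : ℕ) : evalCount queries K ≤ (K + 1) * q := by
  simpa [evalCount] using Finset.sum_le_card_nsmul (Finset.range (K + 1)) _ q fun k _ => hq k

theorem length_lazyQueries_le (m : ℕ) (R : Iterates n) (k : ℕ) :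
    (lazyQueries m R k).length ≤ 3 := by
  unfold lazyQueries
  split_ifs <;> simp

theorem length_fdQueries_le [NeZero n] (m : ℕ) (R : Iterates n) (k : ℕ) :
    (fdQueries m R k).length ≤ 3 * n := by
  have hn := NeZero.one_le (n := n)
  unfold fdQueries
  split_ifs <;> simp only [List.length_append, List.length_cons, List.length_nil,
    List.length_ofFn] <;> omega

theorem IsPSBRun.exists_evalCount_le [NeZero n] (hR : IsPSBRun f L m θ₁ θ₂ σ₀ x₀ R)
    (hm : 1 ≤ m) (hσ₀ : 0 < σ₀) (hf : ContDiff ℝ 3 f)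
    (hL : LipschitzWith L (iteratedFDeriv ℝ 3 f)) (hκ : ∀ x, ‖iteratedFDeriv ℝ 3 f x‖ ≤ κ)
    (hflow : ∀ x, flow ≤ f x) (hx₀ : StartBounds f flow x₀ Δ G B) (hε₁ : 0 < ε₁)
    (hε₂ : 0 < ε₂) (hε : min ε₁ ε₂ ≤ 1) {queries : ℕ → List (Query n)} {q : ℕ}
    (hq : ∀ k, (queries k).length ≤ q) :
    ∃ K : ℕ, IsApproxSecondOrder f ε₁ ε₂ (R.x K) ∧
      evalCount queries K ≤ ((runConstants m hσ₀ θ₁ θ₂ L κ Δ G B).complexityConstant + 1) *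
        (q * max (ε₁ ^ (-(4 / 3) : ℝ)) (ε₂ ^ (-2 : ℝ))) := by
  obtain ⟨K, hK, hKM⟩ := hR.exists_isApproxSecondOrder hm hσ₀ hf hL hκ hflow hx₀ hε₁ hε₂ hε
  have hM := one_le_max_rpow_of_min_le_one (a := -(4 / 3)) (b := -2) hε₁ hε₂ hε
    (by norm_num) (by norm_num)
  refine ⟨K, hK, ?_⟩
  calc (evalCount queries K : ℝ) ≤ (K + 1) * q := mod_cast evalCount_le hq K
    _ ≤ ((runConstants m hσ₀ θ₁ θ₂ L κ Δ G B).complexityConstant *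
          max (ε₁ ^ (-(4 / 3) : ℝ)) (ε₂ ^ (-2 : ℝ)) +
          max (ε₁ ^ (-(4 / 3) : ℝ)) (ε₂ ^ (-2 : ℝ))) * q := by gcongr
    _ = _ := by ring

end Complexity

end PSBThree

theorem mainTheorem5_general (m : ℕ) (hm : 1 ≤ m) (σ₀ θ₁ θ₂ : ℝ) (hσ₀ : 0 < σ₀) (L : NNReal)
    (κ Δ G B : ℝ) :
    (∃ C : ℝ, 0 < C ∧
      ∀ (n : ℕ), 1 ≤ n → ∀ (f : Vec n → ℝ) (flow : ℝ) (x₀ : Vec n),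
        ContDiff ℝ 3 f → (∀ x, flow ≤ f x) → LipschitzWith L (iteratedFDeriv ℝ 3 f) →
        (∀ x, ‖iteratedFDeriv ℝ 3 f x‖ ≤ κ) → StartBounds f flow x₀ Δ G B →
        ∀ R : Iterates n, IsLazyRestartRun f m θ₁ θ₂ σ₀ x₀ R →
        ∀ ε₁ ε₂ : ℝ, 0 < ε₁ → 0 < ε₂ → min ε₁ ε₂ ≤ 1 →
          ∃ K : ℕ, IsApproxSecondOrder f ε₁ ε₂ (R.x K) ∧
            (evalCount (lazyQueries m R) K : ℝ)
              ≤ C * max (ε₁ ^ (-(4 / 3) : ℝ)) (ε₂ ^ (-2 : ℝ))) ∧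
    (∃ C : ℝ, 0 < C ∧
      ∀ (n : ℕ), 1 ≤ n → ∀ (f : Vec n → ℝ) (flow : ℝ) (x₀ : Vec n),
        ContDiff ℝ 3 f → (∀ x, flow ≤ f x) → LipschitzWith L (iteratedFDeriv ℝ 3 f) →
        (∀ x, ‖iteratedFDeriv ℝ 3 f x‖ ≤ κ) → StartBounds f flow x₀ Δ G B →
        ∀ R : Iterates n, IsFDRestartRun f m θ₁ θ₂ σ₀ x₀ R →
        ∀ ε₁ ε₂ : ℝ, 0 < ε₁ → 0 < ε₂ → min ε₁ ε₂ ≤ 1 →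
          ∃ K : ℕ, IsApproxSecondOrder f ε₁ ε₂ (R.x K) ∧
            (evalCount (fdQueries m R) K : ℝ)
              ≤ C * (n * max (ε₁ ^ (-(4 / 3) : ℝ)) (ε₂ ^ (-2 : ℝ)))) := by
  set P := runConstants m hσ₀ θ₁ θ₂ L κ Δ G B
  have hC : 0 < (P.complexityConstant + 1) * 3 := by linarith [P.complexityConstant_pos]
  refine ⟨⟨_, hC, fun n hn f flow x₀ hf hflow hL hκ hx₀ R hR ε₁ ε₂ hε₁ hε₂ hε => ?_⟩,
    ⟨_, hC, fun n hn f flow x₀ hf hflow hL hκ hx₀ R hR ε₁ ε₂ hε₁ hε₂ hε => ?_⟩⟩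
  · have : NeZero n := ⟨by omega⟩
    obtain ⟨K, hK, hcount⟩ := (hR.isPSBRun hf L).exists_evalCount_le hm hσ₀ hf hL hκ hflow hx₀
      hε₁ hε₂ hε (length_lazyQueries_le m R)
    exact ⟨K, hK, hcount.trans_eq (by push_cast; ring)⟩
  · have : NeZero n := ⟨by omega⟩
    obtain ⟨K, hK, hcount⟩ := (hR.isPSBRun hm hf hL).exists_evalCount_le hm hσ₀ hf hL hκ hflow
      hx₀ hε₁ hε₂ hε (length_fdQueries_le m R)
    exact ⟨K, hK, hcount.trans_eq (by push_cast; ring)⟩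

theorem mainTheorem5 (m : ℕ) (hm : 1 ≤ m) (σ₀ θ₁ θ₂ : ℝ) (hσ₀ : 0 < σ₀) (hθ₁ : 1 < θ₁)
    (hθ₂ : 1 < θ₂) (L κ Δ G B : ℝ) :
    (∃ C : ℝ, 0 < C ∧
      ∀ (n : ℕ), 1 ≤ n → ∀ (f : Vec n → ℝ) (flow : ℝ) (x₀ : Vec n),
        ObjectiveAssumptions f flow L κ → StartBounds f flow x₀ Δ G B →
        ∀ R : Iterates n, IsLazyRestartRun f m θ₁ θ₂ σ₀ x₀ R →
        ∀ ε₁ ε₂ : ℝ, 0 < ε₁ → 0 < ε₂ → min ε₁ ε₂ ≤ 1 →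
          ∃ K : ℕ, IsApproxSecondOrder f ε₁ ε₂ (R.x K) ∧
            (evalCount (lazyQueries m R) K : ℝ)
              ≤ C * max (ε₁ ^ (-(4 / 3) : ℝ)) (ε₂ ^ (-2 : ℝ))) ∧
    (∃ C : ℝ, 0 < C ∧
      ∀ (n : ℕ), 1 ≤ n → ∀ (f : Vec n → ℝ) (flow : ℝ) (x₀ : Vec n),
        ObjectiveAssumptions f flow L κ → StartBounds f flow x₀ Δ G B →
        ∀ R : Iterates n, IsFDRestartRun f m θ₁ θ₂ σ₀ x₀ R →
        ∀ ε₁ ε₂ : ℝ, 0 < ε₁ → 0 < ε₂ → min ε₁ ε₂ ≤ 1 →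
          ∃ K : ℕ, IsApproxSecondOrder f ε₁ ε₂ (R.x K) ∧
            (evalCount (fdQueries m R) K : ℝ)
              ≤ C * (n * max (ε₁ ^ (-(4 / 3) : ℝ)) (ε₂ ^ (-2 : ℝ)))) := by
  obtain ⟨⟨C, hC, hlazy⟩, ⟨C', hC', hfd⟩⟩ :=
    mainTheorem5_general m hm σ₀ θ₁ θ₂ hσ₀ L.toNNReal κ Δ G B
  exact ⟨⟨C, hC, fun n hn f flow x₀ hf =>
      hlazy n hn f flow x₀ hf.smooth hf.bounded_below hf.lipschitzWith hf.bounded_third⟩,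
    ⟨C', hC', fun n hn f flow x₀ hf =>
      hfd n hn f flow x₀ hf.smooth hf.bounded_below hf.lipschitzWith hf.bounded_third⟩⟩
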